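/- Let $\mathcal H=L^2(\mathbb R)$ (real-valued functions), let $\mathfrak g$ be the space of Hilbert–Schmidt operators on $\mathcal H$, i.e. the integral operators with kernel in $L^2(\mathbb R^2)$, with the Hilbert–Schmidt norm (the $L^2(\mathbb R^2)$-norm of the kernel), and let $G$ be the group of invertible bounded operators $g$ with $g-I\in\mathfrak g$. Let $\mathfrak l\subset\mathfrak g$ consist of the Volterra operators $(A\varphi)(x)=\int_{-\infty}^x A(x,y)\varphi(y)\,dy$ with $L^2$ kernel and $\mathfrak k=\{B\in\mathfrak g: B^*=-B\}$. Then $\mathfrak g=\mathfrak l\oplus\mathfrak k$, and the corresponding projections of an operator with kernel $K(x,y)$ have the kernels $$\Pi_{\mathfrak l}\boldsymbol K:\ (K(x,y)+K(y,x))\chi_{y<x},\qquad \Pi_{\mathfrak k}\boldsymbol K:\ K(x,y)\chi_{x<y}-K(y,x)\chi_{y<x}.$$ Put $\mathcal L=I+\mathfrak l$ and $\mathcal K=\{k\in G: kk^*=k^*k=I\}$. **Theorem 3.2.** Let $\boldsymbol K_0\in\mathfrak g$. For every $t\in\mathbb R$ there are unique $b_-(t)\in\mathcal L$ and $b_+(t)\in\mathcal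 K$ with $$\exp\left(-\tfrac12 t\boldsymbol K_0\right)=b_-(t)\circ b_+(t)^{-1}.$$ For all $t$ one has $b_-(t)^{-1}\circ\boldsymbol K_0\circ b_-(t)=b_+(t)^{-1}\circ\boldsymbol K_0\circ b_+(t)$. This operator, denoted by $\boldsymbol K(t)$, lies in $\mathfrak g$, is differentiable in $t$ with respect to the Hilbert–Schmidt norm, and satisfies for all $t\in\mathbb R$ $$\dot{\boldsymbol K}=\tfrac12[\Pi_{\mathfrak l}\boldsymbol K,\boldsymbol K]=\tfrac12[\boldsymbol K,\Pi_{\mathfrak k}\boldsymbol K],\qquad \boldsymbol K(0)=\boldsymbol K_0.$$ If moreover $\boldsymbol K_0=\boldsymbol K_0^*$, with kernel $K(x,y)$, then $\boldsymbol K(t)=\boldsymbol K(t)^*$ for all $t$, and the kernel $K(x,y;t)$ of $\boldsymbol K(t)$ solves the integro-differential equation $$\dot K(x,y;t)=\int_{-\infty}^x K(x,z;t)K(z,y;t)\,dz-\int_y^\infty K(x,z;t)K(z,y;t)\,dz=\int_{-\infty}^y K(x,z;t)K(z,y;t)\,dz-\int_x^\infty K(x,z;t)K(z,y;t)\,dz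 \tag{2.24}$$ (the $t$-derivative being taken in $L^2(\mathbb R^2)$, and the equalities holding for almost every $(x,y)$). The solution is explicit: let $S(x,y;t)$ be the kernel of $\exp(-t\boldsymbol K_0)-I=:\boldsymbol S(t)$ and $C_+(x,y;t)$ the kernel of $(b_-(t)^{-1})^*-I$. Then $C_+(x,y;t)=0$ for $y<x$, while for almost every $y$ the function $C_+(\cdot,y;t)$ on $(-\infty,y)$ is the unique solution in $L^2(-\infty,y)$ of the Fredholm equation $$C_+(x,y;t)+\int_{-\infty}^yS(x,z;t)C_+(z,y;t)\,dz=-S(x,y;t),\qquad x<y,$$ and, for almost every $(\xi,\eta)$, $$K(\xi,\eta;t)=K(\xi,\eta)+\int_{\mathbb R}C_+(\zeta,\xi;t)K(\zeta,\eta)\,d\zeta+\int_\eta^\infty\Big(K(\xi,\zeta_2)+\int_{\mathbb R}C_+(\zeta_1,\xi;t)K(\zeta_1,\zeta_2)\,d\zeta_1\Big)\Big(S(\zeta_2,\eta;t)+\int_{\mathbb R}S(\zeta_2,\zeta_3;t)C_+(\zeta_3,\eta;t)\,d\zeta_3\Big)d\zeta_2.$$ -/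

import Mathlib

open MeasureTheory Set

noncomputable section

namespace HSToda

/-- The real Hilbert space `L²(ℝ)`. -/
abbrev H : Type := Lp ℝ 2 (volume : Measure ℝ)

/-- The bounded operators on `L²(ℝ)`; multiplication is composition. -/
abbrev Op : Type := H →L[ℝ] H

/-- The Hilbert space `L²(ℝ²)` of kernels. -/
abbrev Ker : Type := Lp ℝ 2 (volume : Measure (ℝ × ℝ))

/-- `K` is a Hilbert-Schmidt operator: `∑ ‖K eᵢ‖² < ∞` for an orthonormal (Hilbert) basis `e`. -/
def IsHilbertSchmidt (K : Op) : Prop :=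
  ∃ (ι : Type) (e : HilbertBasis ι ℝ H), Summable fun i => ‖K (e i)‖ ^ 2

/-! ### Integral operators with square integrable kernels -/

lemma norm_sq_eq_integral {α : Type*} [MeasurableSpace α] {μ : Measure α} (f : Lp ℝ 2 μ) :
    ‖f‖ ^ 2 = ∫ x, (f x) ^ 2 ∂μ := by
  rw [← real_inner_self_eq_norm_sq, L2.inner_def]
  refine integral_congr_ae (ae_of_all _ fun x => ?_)
  simp [sq]

lemma sq_integral_mul_le {f : ℝ → ℝ} (hf : MemLp f 2 volume) (φ : H) :
    (∫ y, f y * φ y) ^ 2 ≤ (∫ y, f y ^ 2) * ‖φ‖ ^ 2 := by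
  have h1 : ∫ y, f y * φ y = inner ℝ (hf.toLp f) φ := by
    rw [L2.inner_def]
    refine integral_congr_ae ?_
    filter_upwards [hf.coeFn_toLp] with y hy
    simp [hy, mul_comm]
  have h2 : ∫ y, f y ^ 2 = ‖hf.toLp f‖ ^ 2 := by
    rw [norm_sq_eq_integral]
    refine integral_congr_ae ?_
    filter_upwards [hf.coeFn_toLp] with y hy
    rw [hy]
  rw [h1, h2, ← mul_pow]
  exact sq_le_sq' (abs_le.1 (abs_real_inner_le_norm _ _)).1
    (abs_le.1 (abs_real_inner_le_norm _ _)).2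

lemma ker_sq_integrable (κ : Ker) :
    Integrable (fun p : ℝ × ℝ => κ p ^ 2) ((volume : Measure ℝ).prod volume) :=
  (memLp_two_iff_integrable_sq (Lp.aestronglyMeasurable κ)).1 (Lp.memLp κ)

lemma ker_section_memLp (κ : Ker) :
    ∀ᵐ x : ℝ, MemLp (fun y => κ (x, y)) 2 (volume : Measure ℝ) := by
  have hm : AEStronglyMeasurable (fun p : ℝ × ℝ => κ p) ((volume : Measure ℝ).prod volume) :=
    Lp.aestronglyMeasurable κ
  filter_upwards [(ker_sq_integrable κ).prod_right_ae, hm.prodMk_left] with x hx hx'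
  exact (memLp_two_iff_integrable_sq hx').2 hx

/-- The function `x ↦ ∫ κ(x,y) φ(y) dy`. -/
def kerApply (κ : Ker) (φ : H) (x : ℝ) : ℝ := ∫ y, κ (x, y) * φ y

lemma kerApply_aesm (κ : Ker) (φ : H) : AEStronglyMeasurable (kerApply κ φ) volume := by
  have hm : AEStronglyMeasurable (fun p : ℝ × ℝ => κ p) ((volume : Measure ℝ).prod volume) :=
    Lp.aestronglyMeasurable κ
  have hφ : AEStronglyMeasurable (fun p : ℝ × ℝ => φ p.2) ((volume : Measure ℝ).prod volume) :=
    (Lp.aestronglyMeasurable φ).comp_snd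
  exact (hm.mul hφ).integral_prod_right'

lemma kerApply_sq_le (κ : Ker) (φ : H) :
    ∀ᵐ x : ℝ, kerApply κ φ x ^ 2 ≤ (∫ y, κ (x, y) ^ 2) * ‖φ‖ ^ 2 := by
  filter_upwards [ker_section_memLp κ] with x hx
  exact sq_integral_mul_le hx φ

lemma kerApply_memLp (κ : Ker) (φ : H) : MemLp (kerApply κ φ) 2 volume := by
  refine (memLp_two_iff_integrable_sq (kerApply_aesm κ φ)).2 ?_
  refine ((ker_sq_integrable κ).integral_prod_left.mul_const (‖φ‖ ^ 2)).mono'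
    ((kerApply_aesm κ φ).pow 2) ?_
  filter_upwards [kerApply_sq_le κ φ] with x hx
  rwa [Real.norm_of_nonneg (sq_nonneg _)]

lemma kerApply_norm_le (κ : Ker) (φ : H) :
    ‖(kerApply_memLp κ φ).toLp (kerApply κ φ)‖ ≤ ‖κ‖ * ‖φ‖ := by
  refine le_of_sq_le_sq ?_ (by positivity)
  rw [norm_sq_eq_integral, mul_pow, norm_sq_eq_integral κ]
  have h1 : ∫ x, ((kerApply_memLp κ φ).toLp (kerApply κ φ) x) ^ 2 = ∫ x, kerApply κ φ x ^ 2 := by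
    refine integral_congr_ae ?_
    filter_upwards [(kerApply_memLp κ φ).coeFn_toLp] with x hx
    rw [hx]
  have h2 : ∫ p : ℝ × ℝ, κ p ^ 2 = ∫ x : ℝ, ∫ y : ℝ, κ (x, y) ^ 2 :=
    integral_prod _ (ker_sq_integrable κ)
  rw [h1, h2, ← integral_mul_const]
  exact integral_mono_ae ((memLp_two_iff_integrable_sq (kerApply_aesm κ φ)).1
    (kerApply_memLp κ φ)) ((ker_sq_integrable κ).integral_prod_left.mul_const (‖φ‖ ^ 2))
    (kerApply_sq_le κ φ)

/-- The integral operator `(T φ)(x) = ∫ κ(x,y) φ(y) dy` on `L²(ℝ)` with kernel `κ ∈ L²(ℝ²)`. -/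
def integralOp (κ : Ker) : Op :=
  LinearMap.mkContinuous
    { toFun := fun φ => (kerApply_memLp κ φ).toLp (kerApply κ φ)
      map_add' := by
        intro φ ψ
        rw [← MemLp.toLp_add, MemLp.toLp_eq_toLp_iff]
        filter_upwards [ker_section_memLp κ] with x hx
        have h1 : Integrable (fun y => κ (x, y) * φ y) := hx.integrable_mul (Lp.memLp φ)
        have h2 : Integrable (fun y => κ (x, y) * ψ y) := hx.integrable_mul (Lp.memLp ψ)
        rw [Pi.add_apply, kerApply, kerApply, kerApply, ← integral_add h1 h2]
        refine integral_congr_ae ?_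
        filter_upwards [Lp.coeFn_add φ ψ] with y hy
        rw [hy, Pi.add_apply, mul_add]
      map_smul' := by
        intro c φ
        rw [RingHom.id_apply, ← MemLp.toLp_const_smul, MemLp.toLp_eq_toLp_iff]
        refine ae_of_all _ fun x => ?_
        rw [Pi.smul_apply, kerApply, kerApply, smul_eq_mul, ← integral_const_mul]
        refine integral_congr_ae ?_
        filter_upwards [Lp.coeFn_smul c φ] with y hy
        simp [hy, mul_left_comm] }
    ‖κ‖ (kerApply_norm_le κ)

lemma integralOp_apply (κ : Ker) (φ : H) :
    integralOp κ φ =ᵐ[volume] fun x => ∫ y, κ (x, y) * φ y :=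
  (kerApply_memLp κ φ).coeFn_toLp

open Classical in
/-- The kernel of an operator: the (unique) `κ ∈ L²(ℝ²)` such that `K` is the integral operator
with kernel `κ`. Every Hilbert-Schmidt operator has one; other operators have none, and the value
there is `0`. -/
def kernel (K : Op) : Ker :=
  if h : ∃ κ : Ker, integralOp κ = K then h.choose else 0

/-! ### The projections onto lower triangular and skew-symmetric operators -/

lemma ker_swap_memLp (κ : Ker) :
    MemLp (fun p : ℝ × ℝ => κ p.swap) 2 (volume : Measure (ℝ × ℝ)) :=
  (Lp.memLp κ).comp_measurePreserving Measure.measurePreserving_swap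

lemma measurableSet_below : MeasurableSet {p : ℝ × ℝ | p.2 < p.1} :=
  measurableSet_lt measurable_snd measurable_fst

lemma measurableSet_above : MeasurableSet {p : ℝ × ℝ | p.1 < p.2} :=
  measurableSet_lt measurable_fst measurable_snd

/-- The kernel `(κ(x,y) + κ(y,x)) χ_{y < x}`. -/
def kerL (κ : Ker) : Ker :=
  (((Lp.memLp κ).add (ker_swap_memLp κ)).indicator measurableSet_below).toLp
    ({p : ℝ × ℝ | p.2 < p.1}.indicator ((fun p => κ p) + fun p => κ p.swap))

/-- The kernel `κ(x,y) χ_{x < y} - κ(y,x) χ_{y < x}`. -/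
def kerK (κ : Ker) : Ker :=
  (((Lp.memLp κ).indicator measurableSet_above).sub
    ((ker_swap_memLp κ).indicator measurableSet_below)).toLp
    ({p : ℝ × ℝ | p.1 < p.2}.indicator (fun p => κ p) -
      {p : ℝ × ℝ | p.2 < p.1}.indicator fun p => κ p.swap)

/-- The projection `Π_𝔩` of the Hilbert-Schmidt operators onto `𝔩` along `𝔨`. -/
def projL (K : Op) : Op := integralOp (kerL (kernel K))

/-- The projection `Π_𝔨` of the Hilbert-Schmidt operators onto `𝔨` along `𝔩`. -/
def projK (K : Op) : Op := integralOp (kerK (kernel K))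

/-- The lower triangular subalgebra `𝔩`: the Volterra operators
`(A φ)(x) = ∫_{-∞}^x a(x,y) φ(y) dy` with `a ∈ L²(ℝ²)`. -/
def lowerAlgebra : Set Op :=
  {A | ∃ a : Ker, ∀ φ : H, A φ =ᵐ[volume] fun x => ∫ y in Iio x, a (x, y) * φ y}

/-! ### The groups -/

/-- The Hilbert-Schmidt group: the invertible bounded operators `g` such that `g - I` is
Hilbert-Schmidt. -/
def hsGroup : Set Opˣ := {g | IsHilbertSchmidt ((g : Op) - 1)}

/-- The group `𝓛 = I + 𝔩`. -/
def lowerGroup : Set Opˣ := {b | (b : Op) - 1 ∈ lowerAlgebra}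

/-- The group `𝓚` of the orthogonal operators in the Hilbert-Schmidt group. -/
def orthGroup : Set Opˣ :=
  {k | k ∈ hsGroup ∧ (k : Op) * ContinuousLinearMap.adjoint (k : Op) = 1 ∧
    ContinuousLinearMap.adjoint (k : Op) * (k : Op) = 1}

/-- `(b₋, b₊)` solves the factorization problem `g = b₋ ∘ b₊⁻¹`, `b₋ ∈ 𝓛`, `b₊ ∈ 𝓚`. -/
def IsFactorization (g : Op) (bm bp : Opˣ) : Prop :=
  bm ∈ lowerGroup ∧ bp ∈ orthGroup ∧ g = (bm : Op) * ((bp⁻¹ : Opˣ) : Op)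

/-! ### Differential equations for Hilbert-Schmidt operators and the explicit solution -/

/-- The curve `K` of Hilbert-Schmidt operators is differentiable at `t` with derivative the
Hilbert-Schmidt operator `D`, with respect to the Hilbert-Schmidt norm, that is, the `L²(ℝ²)`-norm
of the kernels. -/
def HasHSDerivAt (K : ℝ → Op) (D : Op) (t : ℝ) : Prop :=
  (∀ s, IsHilbertSchmidt (K s)) ∧ IsHilbertSchmidt D ∧
    HasDerivAt (fun s => kernel (K s)) (kernel D) t

/-- The integro-differential equation
`∂ₜ κ(x,y;t) = ∫_{-∞}^x κ(x,z;t) κ(z,y;t) dz - ∫_y^∞ κ(x,z;t) κ(z,y;t) dz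
            = ∫_{-∞}^y κ(x,z;t) κ(z,y;t) dz - ∫_x^∞ κ(x,z;t) κ(z,y;t) dz`
at time `t`, for a curve `κ` in `L²(ℝ²)`. The products under the integrals are integrable over `ℝ`
for almost every `(x,y)`. -/
def SolvesIDEAt (κ : ℝ → Ker) (t : ℝ) : Prop :=
  ∃ D : Ker, HasDerivAt κ D t ∧
    ∀ᵐ p : ℝ × ℝ,
      Integrable (fun z => κ t (p.1, z) * κ t (z, p.2)) ∧
      D p = (∫ z in Iio p.1, κ t (p.1, z) * κ t (z, p.2)) -
        ∫ z in Ioi p.2, κ t (p.1, z) * κ t (z, p.2) ∧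
      D p = (∫ z in Iio p.2, κ t (p.1, z) * κ t (z, p.2)) -
        ∫ z in Ioi p.1, κ t (p.1, z) * κ t (z, p.2)

/-- `f ∈ L²(-∞,y)` solves the Fredholm equation `(I + S)|_{(-∞,y)} f = -S(·,y)`. -/
def IsFredholmSolution (S : Ker) (y : ℝ) (f : ℝ → ℝ) : Prop :=
  MemLp f 2 (volume.restrict (Iio y)) ∧
    ∀ᵐ x ∂(volume.restrict (Iio y)), f x + ∫ z in Iio y, S (x, z) * f z = -S (x, y)

/-- `C(x,y) = -(((I + S)|_{(-∞,y)})⁻¹ S(·,y))(x)` for `x < y`, and `C(x,y) = 0` for `y < x`. -/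
def IsResolventKernel (S C : Ker) : Prop :=
  (∀ᵐ p : ℝ × ℝ, p.2 < p.1 → C p = 0) ∧
    ∀ᵐ y : ℝ, IsFredholmSolution S y (fun x => C (x, y)) ∧
      ∀ f : ℝ → ℝ, IsFredholmSolution S y f →
        f =ᵐ[volume.restrict (Iio y)] fun x => C (x, y)

/-- The right-hand side, at `(ξ,η)`, of the explicit formula for the solution with initial kernel
`k`, in terms of the kernels `S` and `C`. -/
def explicitKernel (k S C : Ker) (p : ℝ × ℝ) : ℝ :=
  k p + (∫ ζ, C (ζ, p.1) * k (ζ, p.2)) +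
    ∫ ζ₂ in Ioi p.2, (k (p.1, ζ₂) + ∫ ζ₁, C (ζ₁, p.1) * k (ζ₁, ζ₂)) *
      (S (ζ₂, p.2) + ∫ ζ₃, S (ζ₂, ζ₃) * C (ζ₃, p.2))

end HSToda

end

/-!
The theorem rests on three facts about the Hilbert space `L²(ℝ²)` of kernels.

Hilbert-Schmidt operators are exactly the integral operators with kernel in `L²(ℝ²)`, and the
correspondence is isometric (`isHilbertSchmidt_iff`, `hasSum_inner_integralOp`): a Hilbert basis `e`
of `L²(ℝ)` gives the Hilbert basis `eⱼ(x) eᵢ(y)` of `L²(ℝ²)`. Consequently bounded operators act on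
kernels by left multiplication (`leftMul`), continuously in both arguments, and composition of
kernels is given by the expected integral (`leftMul_integralOp_ae`).

Volterra operators are quasi-nilpotent (`factorial_mul_norm_volterra_pow_le`), so `I + 𝔩` is a group
(`exists_lower_inverse`).

A factorization `g = b₋ b₊⁻¹` amounts to `b₋ b₋* = g g* =: I + S`, because `b₊` is orthogonal. It is
unique since a lower triangular operator `I + A` that is also orthogonal is the identity
(`IsFactorization.unique`). To find `b₋`, solve `P (C + S C) = -P S` for an upper triangular kernel
`C`, where `P` is the projection of `L²(ℝ²)` onto the upper triangular kernels. As `I + S` is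
positive definite and `P` is orthogonal, this linear equation is coercive, hence uniquely solvable
(`isUnit_upCompression`). Then `(I + S)(I + C)` is `I +` lower triangular, therefore
`(I + C*)(I + S)(I + C)` is both symmetric and of the form `I +` lower triangular, so it is `I`
(`resolvent_mul_lowerFactor`) and `b₋ = (I + S)(I + C) = (I + C*)⁻¹`.

This construction makes the rest explicit. The kernel `S` is differentiable in `t`, hence so are the
coefficients of the linear equation and its solution `C`. Differentiating `b₋ b₋* = g g*` with
`g = exp (t X)`, `X = -K₀ / 2`, shows that `b₋⁻¹ ḃ₋` is the component in `𝔩` of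
`b₋⁻¹ X b₋ = -K(t) / 2`, and the Lax equation follows (`exists_hasDerivAt_laxKer`). Fixing `y` in
the equation for `C(x,y)` gives the Fredholm equations, whose solutions are unique by
positivity (`isResolventKernel_resolventKer`), and expanding `(I + C*) K₀ (I + S)(I + C)` gives the
explicit formula (`laxKer_ae_eq_explicitKernel`).
-/

noncomputable section

namespace HSToda

instance : Fact ((2 : ENNReal) ≠ ⊤) := ⟨by norm_num⟩

instance : SecondCountableTopology H := inferInstanceAs (SecondCountableTopology (Lp ℝ 2 volume))

/-! ### Hilbert-Schmidt operators and square integrable kernels -/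

lemma tensor_memLp (f g : H) :
    MemLp (fun p : ℝ × ℝ => f p.1 * g p.2) 2 (volume : Measure (ℝ × ℝ)) := by
  have hm : AEStronglyMeasurable (fun p : ℝ × ℝ => f p.1 * g p.2)
      ((volume : Measure ℝ).prod volume) :=
    (Lp.aestronglyMeasurable f).comp_fst.mul (Lp.aestronglyMeasurable g).comp_snd
  refine (memLp_two_iff_integrable_sq hm).2 ?_
  have hf := (memLp_two_iff_integrable_sq (Lp.aestronglyMeasurable f)).1 (Lp.memLp f)
  have hg := (memLp_two_iff_integrable_sq (Lp.aestronglyMeasurable g)).1 (Lp.memLp g)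
  simpa [mul_pow] using hf.mul_prod hg

/-- The kernel `f(x) g(y)` of the rank one operator `φ ↦ ⟪g, φ⟫ f`. -/
def tensor (f g : H) : Ker := (tensor_memLp f g).toLp _

lemma coeFn_tensor (f g : H) :
    tensor f g =ᵐ[(volume : Measure ℝ).prod volume] fun p => f p.1 * g p.2 :=
  (tensor_memLp f g).coeFn_toLp

lemma inner_tensor_tensor (f g f' g' : H) :
    inner ℝ (tensor f g) (tensor f' g') = inner ℝ f f' * inner ℝ g g' := by
  rw [L2.inner_def, L2.inner_def, L2.inner_def, ← integral_prod_mul]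
  refine integral_congr_ae ?_
  filter_upwards [coeFn_tensor f g, coeFn_tensor f' g'] with p h1 h2
  rw [h1, h2]
  simp
  ring

/-- The kernel of an operator is determined by its matrix coefficients, which are the inner
products of the kernel with rank one kernels. -/
lemma inner_integralOp (κ : Ker) (f g : H) :
    inner ℝ (integralOp κ g) f = inner ℝ κ (tensor f g) := by
  have hi : Integrable (fun p : ℝ × ℝ => κ p * (f p.1 * g p.2))
      ((volume : Measure ℝ).prod volume) := (Lp.memLp κ).integrable_mul (tensor_memLp f g)
  have h1 : inner ℝ κ (tensor f g) = ∫ p : ℝ × ℝ, κ p * (f p.1 * g p.2) := by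
    rw [L2.inner_def]
    refine integral_congr_ae ?_
    filter_upwards [coeFn_tensor f g] with p h1
    rw [h1]
    simp [mul_comm]
  rw [h1, L2.inner_def]
  refine Eq.trans ?_ (integral_prod _ hi).symm
  refine integral_congr_ae ?_
  filter_upwards [integralOp_apply κ g] with x hx
  rw [hx]
  simp only [RCLike.inner_apply, conj_trivial]
  rw [← integral_const_mul]
  refine integral_congr_ae (ae_of_all _ fun y => ?_)
  simp only
  ring

lemma integralOp_add (κ κ' : Ker) : integralOp (κ + κ') = integralOp κ + integralOp κ' := by
  ext1 g
  refine ext_inner_right ℝ fun f => ?_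
  rw [inner_integralOp, add_apply, inner_add_left, inner_add_left,
    inner_integralOp, inner_integralOp]

lemma integralOp_smul (c : ℝ) (κ : Ker) : integralOp (c • κ) = c • integralOp κ := by
  ext1 g
  refine ext_inner_right ℝ fun f => ?_
  rw [inner_integralOp, smul_apply, inner_smul_left, inner_smul_left,
    inner_integralOp]

/-- The assignment of the integral operator to a kernel, as a continuous linear map. -/
def integralOpL : Ker →L[ℝ] Op :=
  LinearMap.mkContinuous
    { toFun := integralOp
      map_add' := integralOp_add
      map_smul' := integralOp_smul } 1 fun κ => by
    rw [one_mul]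
    exact LinearMap.mkContinuous_norm_le _ (norm_nonneg κ) (kerApply_norm_le κ)

lemma integralOp_zero : integralOp 0 = 0 := integralOpL.map_zero

lemma integralOp_neg (κ : Ker) : integralOp (-κ) = -integralOp κ := integralOpL.map_neg κ

lemma integralOp_sub (κ κ' : Ker) : integralOp (κ - κ') = integralOp κ - integralOp κ' :=
  integralOpL.map_sub κ κ'

/-- Two square integrable functions with the same integrals against a dense sequence agree. -/
lemma ae_eq_of_integral_denseSeq {f g : ℝ → ℝ} (hf : MemLp f 2 volume) (hg : MemLp g 2 volume)
    (h : ∀ n, ∫ y, f y * TopologicalSpace.denseSeq H n y =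
      ∫ y, g y * TopologicalSpace.denseSeq H n y) : f =ᵐ[volume] g := by
  have key : ∀ {f : ℝ → ℝ} (hf : MemLp f 2 volume) (φ : H),
      inner ℝ (hf.toLp f) φ = ∫ y, f y * φ y := by
    intro f hf φ
    rw [L2.inner_def]
    refine integral_congr_ae ?_
    filter_upwards [hf.coeFn_toLp] with y hy
    simp [hy, mul_comm]
  have : hf.toLp f = hg.toLp g := by
    have hd := TopologicalSpace.denseRange_denseSeq H
    refine ext_inner_right ℝ fun φ => ?_
    have hc : ∀ ψ : H, Continuous fun φ : H => (inner ℝ ψ φ : ℝ) := fun ψ =>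
      continuous_const.inner continuous_id
    refine congrFun (hd.equalizer (hc (hf.toLp f)) (hc (hg.toLp g)) ?_) φ
    funext n
    simpa [key] using h n
  exact (MemLp.toLp_eq_toLp_iff hf hg).1 this

lemma ker_ext {κ κ' : Ker} (h : κ =ᵐ[(volume : Measure ℝ).prod volume] κ') : κ = κ' := Lp.ext h

/-- A kernel is determined by its operator: for almost every `x` the section `κ(x,·)` is determined
by its integrals against a dense sequence of `L²(ℝ)`. -/
lemma integralOp_injective : Function.Injective integralOp := by
  intro κ κ' h
  refine ker_ext ?_
  have hm : MeasurableSet {p : ℝ × ℝ | κ p = κ' p} :=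
    measurableSet_eq_fun (Lp.stronglyMeasurable κ).measurable (Lp.stronglyMeasurable κ').measurable
  refine (Measure.ae_prod_iff_ae_ae hm).2 ?_
  have h1 : ∀ n, (fun x => ∫ y, κ (x, y) * TopologicalSpace.denseSeq H n y) =ᵐ[volume]
      fun x => ∫ y, κ' (x, y) * TopologicalSpace.denseSeq H n y := fun n =>
    (integralOp_apply κ _).symm.trans (h ▸ integralOp_apply κ' _)
  filter_upwards [ae_all_iff.2 h1, ker_section_memLp κ, ker_section_memLp κ'] with x hx h2 h3
  exact ae_eq_of_integral_denseSeq h2 h3 hx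

lemma kernel_integralOp (κ : Ker) : kernel (integralOp κ) = κ := by
  have h : ∃ κ' : Ker, integralOp κ' = integralOp κ := ⟨κ, rfl⟩
  rw [kernel, dif_pos h]
  exact integralOp_injective h.choose_spec

lemma op_ext_of_hilbertBasis {ι : Type} (e : HilbertBasis ι ℝ H) {A B : Op}
    (h : ∀ i, A (e i) = B (e i)) : A = B := by
  refine ContinuousLinearMap.ext_on (s := range e) ?_ ?_
  · exact Submodule.dense_iff_topologicalClosure_eq_top.2 e.dense_span
  · rintro _ ⟨i, rfl⟩
    exact h i

/-- A Hilbert basis of `L²(ℝ)` induces a Hilbert basis of `L²(ℝ²)` by rank one kernels. -/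
def tensorBasis {ι : Type} (e : HilbertBasis ι ℝ H) : HilbertBasis (ι × ι) ℝ Ker :=
  HilbertBasis.mkOfOrthogonalEqBot (v := fun p : ι × ι => tensor (e p.2) (e p.1)) (by
    classical
    rw [orthonormal_iff_ite]
    rintro ⟨i, j⟩ ⟨i', j'⟩
    have := orthonormal_iff_ite.1 e.orthonormal
    rw [inner_tensor_tensor, this, this]
    by_cases h1 : i = i' <;> by_cases h2 : j = j' <;> simp [h1, h2]) (by
    rw [Submodule.eq_bot_iff]
    intro κ hκ
    refine integralOp_injective ?_
    have h0 : ∀ i j, inner ℝ (integralOp κ (e i)) (e j) = 0 := by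
      intro i j
      rw [inner_integralOp]
      exact Submodule.inner_left_of_mem_orthogonal
        (Submodule.subset_span (mem_range_self (i, j))) hκ
    have h1 : ∀ i, integralOp κ (e i) = 0 := fun i =>
      ext_inner_right ℝ fun f => by
        have := e.hasSum_inner_mul_inner (integralOp κ (e i)) f
        simp only [h0, zero_mul] at this
        rw [inner_zero_left]
        exact this.unique hasSum_zero
    rw [integralOp_zero]
    exact op_ext_of_hilbertBasis e fun i => by rw [h1, zero_apply])

lemma tensorBasis_apply {ι : Type} (e : HilbertBasis ι ℝ H) (p : ι × ι) :
    tensorBasis e p = tensor (e p.2) (e p.1) := by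
  rw [tensorBasis, HilbertBasis.coe_mkOfOrthogonalEqBot]

/-- The inner product of kernels in `L²(ℝ²)` is the Hilbert-Schmidt inner product. -/
lemma hasSum_inner_integralOp {ι : Type} (e : HilbertBasis ι ℝ H) (κ κ' : Ker) :
    HasSum (fun i => inner ℝ (integralOp κ (e i)) (integralOp κ' (e i))) (inner ℝ κ κ') := by
  refine ((tensorBasis e).hasSum_inner_mul_inner κ κ').prod_fiberwise fun i => ?_
  convert e.hasSum_inner_mul_inner (integralOp κ (e i)) (integralOp κ' (e i)) using 1
  funext j
  rw [tensorBasis_apply, inner_integralOp, real_inner_comm (integralOp κ' (e i)), inner_integralOp,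
    real_inner_comm κ']

lemma hasSum_norm_sq_integralOp {ι : Type} (e : HilbertBasis ι ℝ H) (κ : Ker) :
    HasSum (fun i => ‖integralOp κ (e i)‖ ^ 2) (‖κ‖ ^ 2) := by
  simpa only [real_inner_self_eq_norm_sq] using hasSum_inner_integralOp e κ κ

/-- The matrix coefficients of a Hilbert-Schmidt operator are square summable, hence are the
coefficients of a kernel with respect to the tensor basis. -/
lemma exists_kernel_of_summable {ι : Type} (e : HilbertBasis ι ℝ H) {K : Op}
    (h : Summable fun i => ‖K (e i)‖ ^ 2) : ∃ κ : Ker, integralOp κ = K := by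
  have hs : Summable fun p : ι × ι => ‖inner ℝ (K (e p.1)) (e p.2)‖ ^ 2 := by
    have hj : ∀ i, HasSum (fun j => ‖inner ℝ (K (e i)) (e j)‖ ^ 2) (‖K (e i)‖ ^ 2) := by
      intro i
      rw [← real_inner_self_eq_norm_sq]
      refine (e.hasSum_inner_mul_inner (K (e i)) (K (e i))).congr_fun fun j => ?_
      rw [real_inner_comm (K (e i)) (e j), Real.norm_eq_abs, sq_abs, sq]
    refine (summable_prod_of_nonneg fun _ => by positivity).2 ⟨fun i => (hj i).summable, ?_⟩
    simpa only [(hj _).tsum_eq] using h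
  have hm : Memℓp (fun p : ι × ι => inner ℝ (K (e p.1)) (e p.2)) 2 := by
    refine memℓp_gen ?_
    simpa using hs
  refine ⟨(tensorBasis e).repr.symm ⟨_, hm⟩, op_ext_of_hilbertBasis e fun i => ?_⟩
  refine e.repr.injective ?_
  ext j
  rw [e.repr_apply_apply, e.repr_apply_apply, real_inner_comm, inner_integralOp,
    real_inner_comm (K (e i))]
  have := (tensorBasis e).repr_apply_apply ((tensorBasis e).repr.symm ⟨_, hm⟩) (i, j)
  rw [LinearIsometryEquiv.apply_symm_apply, tensorBasis_apply] at this
  rw [real_inner_comm, ← this]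

/-- The Hilbert-Schmidt operators are the integral operators with kernel in `L²(ℝ²)`. -/
lemma isHilbertSchmidt_iff {K : Op} : IsHilbertSchmidt K ↔ ∃ κ : Ker, integralOp κ = K := by
  constructor
  · rintro ⟨ι, e, h⟩
    exact exists_kernel_of_summable e h
  · rintro ⟨κ, rfl⟩
    obtain ⟨w, e, -⟩ := exists_hilbertBasis ℝ H
    exact ⟨w, e, (hasSum_norm_sq_integralOp e κ).summable⟩

lemma integralOp_kernel {K : Op} (h : IsHilbertSchmidt K) : integralOp (kernel K) = K := by
  obtain ⟨κ, rfl⟩ := isHilbertSchmidt_iff.1 h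
  rw [kernel_integralOp]

lemma isHilbertSchmidt_integralOp (κ : Ker) : IsHilbertSchmidt (integralOp κ) :=
  isHilbertSchmidt_iff.2 ⟨κ, rfl⟩

/-! ### The algebra of kernels -/

lemma exists_kernel_comp (T : Op) (κ : Ker) :
    ∃ κ' : Ker, integralOp κ' = T * integralOp κ ∧ ‖κ'‖ ≤ ‖T‖ * ‖κ‖ := by
  obtain ⟨w, e, -⟩ := exists_hilbertBasis ℝ H
  have hle : ∀ i, ‖(T * integralOp κ) (e i)‖ ^ 2 ≤ ‖T‖ ^ 2 * ‖integralOp κ (e i)‖ ^ 2 := by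
    intro i
    rw [← mul_pow]
    gcongr
    exact T.le_opNorm _
  have hs := (hasSum_norm_sq_integralOp e κ).mul_left (‖T‖ ^ 2)
  obtain ⟨κ', h'⟩ := exists_kernel_of_summable e (K := T * integralOp κ)
    (hs.summable.of_nonneg_of_le (fun _ => by positivity) hle)
  refine ⟨κ', h', le_of_sq_le_sq ?_ (by positivity)⟩
  rw [mul_pow]
  have h2 := hasSum_norm_sq_integralOp e κ'
  rw [h'] at h2
  exact hasSum_le hle h2 hs

/-- The kernel of the composition `T ∘ K` of a bounded operator `T` and the integral operator `K`
with kernel `κ`, as a continuous bilinear function of `T` and `κ`. -/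
def leftMul : Op →L[ℝ] Ker →L[ℝ] Ker :=
  LinearMap.mkContinuous₂
    (LinearMap.mk₂ ℝ (fun T κ => (exists_kernel_comp T κ).choose)
      (fun T T' κ => integralOp_injective (by
        rw [integralOp_add, (exists_kernel_comp _ _).choose_spec.1,
          (exists_kernel_comp _ _).choose_spec.1, (exists_kernel_comp _ _).choose_spec.1, add_mul]))
      (fun c T κ => integralOp_injective (by
        rw [integralOp_smul, (exists_kernel_comp _ _).choose_spec.1,
          (exists_kernel_comp _ _).choose_spec.1, smul_mul_assoc]))
      (fun T κ κ' => integralOp_injective (by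
        rw [(exists_kernel_comp _ _).choose_spec.1, integralOp_add (Exists.choose _),
          (exists_kernel_comp _ _).choose_spec.1, (exists_kernel_comp _ _).choose_spec.1,
          integralOp_add, mul_add]))
      (fun c T κ => integralOp_injective (by
        rw [(exists_kernel_comp _ _).choose_spec.1, integralOp_smul _ (Exists.choose _),
          (exists_kernel_comp _ _).choose_spec.1, integralOp_smul, mul_smul_comm])))
    1 fun T κ => by
      rw [one_mul]
      exact (exists_kernel_comp T κ).choose_spec.2

lemma integralOp_leftMul (T : Op) (κ : Ker) :
    integralOp (leftMul T κ) = T * integralOp κ :=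
  (exists_kernel_comp T κ).choose_spec.1

lemma leftMul_mul (T T' : Op) (κ : Ker) : leftMul (T * T') κ = leftMul T (leftMul T' κ) :=
  integralOp_injective (by simp only [integralOp_leftMul, mul_assoc])

lemma leftMul_one (κ : Ker) : leftMul 1 κ = κ :=
  integralOp_injective (by simp only [integralOp_leftMul, one_mul])

lemma norm_leftMul_le (T : Op) (κ : Ker) : ‖leftMul T κ‖ ≤ ‖T‖ * ‖κ‖ :=
  (exists_kernel_comp T κ).choose_spec.2

/-- The adjoint of left multiplication by `T`, for the Hilbert-Schmidt inner product, is left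
multiplication by `T*`. -/
lemma inner_leftMul (T : Op) (κ κ' : Ker) :
    inner ℝ (leftMul T κ) κ' = inner ℝ κ (leftMul (star T) κ') := by
  obtain ⟨w, e, -⟩ := exists_hilbertBasis ℝ H
  refine (hasSum_inner_integralOp e _ _).unique ?_
  convert hasSum_inner_integralOp e κ (leftMul (star T) κ') using 2 with i
  rw [integralOp_leftMul, integralOp_leftMul, ContinuousLinearMap.star_eq_adjoint,
    mul_apply_eq_comp, mul_apply_eq_comp,
    ContinuousLinearMap.adjoint_inner_right]

/-- The transposed kernel `κ(y,x)`. -/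
def swapKer : Ker →L[ℝ] Ker :=
  (Lp.compMeasurePreservingₗᵢ ℝ Prod.swap
    (Measure.measurePreserving_swap (μ := (volume : Measure ℝ))
      (ν := (volume : Measure ℝ)))).toContinuousLinearMap

lemma coeFn_swapKer (κ : Ker) :
    swapKer κ =ᵐ[(volume : Measure ℝ).prod volume] fun p => κ p.swap :=
  Lp.coeFn_compMeasurePreserving κ (Measure.measurePreserving_swap (μ := (volume : Measure ℝ))
      (ν := (volume : Measure ℝ)))

lemma ae_swap {P : ℝ × ℝ → Prop} (h : ∀ᵐ p ∂((volume : Measure ℝ).prod volume), P p) :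
    ∀ᵐ p ∂((volume : Measure ℝ).prod volume), P p.swap :=
  (Measure.measurePreserving_swap (μ := (volume : Measure ℝ))
      (ν := (volume : Measure ℝ))).quasiMeasurePreserving.ae h

lemma swapKer_swapKer (κ : Ker) : swapKer (swapKer κ) = κ := by
  refine ker_ext ?_
  filter_upwards [coeFn_swapKer (swapKer κ), ae_swap (coeFn_swapKer κ)] with p h1 h2
  rw [h1, h2, Prod.swap_swap]

lemma inner_swapKer (κ κ' : Ker) : inner ℝ (swapKer κ) (swapKer κ') = inner ℝ κ κ' :=
  LinearIsometry.inner_map_map _ κ κ'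

lemma swapKer_tensor (f g : H) : swapKer (tensor f g) = tensor g f := by
  refine ker_ext ?_
  filter_upwards [coeFn_swapKer (tensor f g), ae_swap (coeFn_tensor f g), coeFn_tensor g f]
    with p h1 h2 h3
  rw [h1, h2, h3, mul_comm]
  rfl

lemma integralOp_swapKer (κ : Ker) : integralOp (swapKer κ) = star (integralOp κ) := by
  ext1 g
  refine ext_inner_right ℝ fun f => ?_
  rw [inner_integralOp, ← swapKer_tensor, inner_swapKer, ContinuousLinearMap.star_eq_adjoint,
    ContinuousLinearMap.adjoint_inner_left, real_inner_comm _ g,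
    inner_integralOp]

/-- The kernel of a product of two integral operators is the composition of the kernels. -/
lemma leftMul_integralOp_ae (κ₁ κ₂ : Ker) :
    leftMul (integralOp κ₁) κ₂ =ᵐ[(volume : Measure ℝ).prod volume]
      fun p => ∫ z, κ₁ (p.1, z) * κ₂ (z, p.2) := by
  have hQ : StronglyMeasurable fun p : ℝ × ℝ => ∫ z, κ₁ (p.1, z) * κ₂ (z, p.2) := by
    refine StronglyMeasurable.integral_prod_right'
      (f := fun q : (ℝ × ℝ) × ℝ => κ₁ (q.1.1, q.2) * κ₂ (q.2, q.1.2)) ?_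
    exact ((Lp.stronglyMeasurable κ₁).comp_measurable (by fun_prop)).mul
      ((Lp.stronglyMeasurable κ₂).comp_measurable (by fun_prop))
  refine (Measure.ae_prod_iff_ae_ae (measurableSet_eq_fun
    (Lp.stronglyMeasurable _).measurable hQ.measurable)).2 ?_
  set φ := TopologicalSpace.denseSeq H
  have h1 : ∀ n, ∀ᵐ x : ℝ, ∫ y, leftMul (integralOp κ₁) κ₂ (x, y) * φ n y =
      ∫ z, κ₁ (x, z) * integralOp κ₂ (φ n) z := by
    intro n
    have h := integralOp_apply (leftMul (integralOp κ₁) κ₂) (φ n)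
    rw [integralOp_leftMul] at h
    exact h.symm.trans (integralOp_apply κ₁ (integralOp κ₂ (φ n)))
  filter_upwards [ae_all_iff.2 h1, ker_section_memLp κ₁,
    ker_section_memLp (leftMul (integralOp κ₁) κ₂)] with x hx hx1 hx2
  -- both sides are the section `κ₁(x,·)`, transformed by the transpose of the second operator
  set f : H := hx1.toLp _
  have hsw : integralOp (swapKer κ₂) f =ᵐ[volume] fun y => ∫ z, κ₁ (x, z) * κ₂ (z, y) := by
    filter_upwards [integralOp_apply (swapKer κ₂) f, Measure.ae_ae_of_ae_prod (coeFn_swapKer κ₂)]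
      with y hy hy2
    rw [hy]
    refine integral_congr_ae ?_
    filter_upwards [hy2, hx1.coeFn_toLp] with z hz hz2
    rw [hz, hz2, mul_comm]
    rfl
  refine (ae_eq_of_integral_denseSeq hx2 (Lp.memLp (integralOp (swapKer κ₂) f))
    fun n => ?_).trans hsw
  rw [hx n]
  have e1 : ∫ z, κ₁ (x, z) * integralOp κ₂ (φ n) z = inner ℝ f (integralOp κ₂ (φ n)) := by
    rw [L2.inner_def]
    refine integral_congr_ae ?_
    filter_upwards [hx1.coeFn_toLp] with z hz
    rw [hz]
    simp [mul_comm]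
  rw [e1, ← ContinuousLinearMap.adjoint_inner_left, ← ContinuousLinearMap.star_eq_adjoint,
    ← integralOp_swapKer, L2.inner_def]
  refine integral_congr_ae (ae_of_all _ fun y => ?_)
  simp [mul_comm, φ]

/-! ### Triangular kernels -/

/-- Restriction of kernels to a measurable subset of the plane, extended by zero. -/
def cutKer (A : Set (ℝ × ℝ)) (hA : MeasurableSet A) : Ker →L[ℝ] Ker :=
  LinearMap.mkContinuous
    { toFun := fun κ => ((Lp.memLp κ).indicator hA).toLp (A.indicator κ)
      map_add' := by
        intro κ κ'
        rw [← MemLp.toLp_add, MemLp.toLp_eq_toLp_iff]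
        filter_upwards [Lp.coeFn_add κ κ'] with p hp
        classical
        rw [Pi.add_apply, indicator_apply, indicator_apply, indicator_apply, hp]
        split_ifs <;> simp
      map_smul' := by
        intro c κ
        rw [RingHom.id_apply, ← MemLp.toLp_const_smul, MemLp.toLp_eq_toLp_iff]
        filter_upwards [Lp.coeFn_smul c κ] with p hp
        classical
        rw [Pi.smul_apply, indicator_apply, indicator_apply, hp]
        split_ifs <;> simp } 1 fun κ => by
    rw [one_mul]
    refine Lp.norm_le_norm_of_ae_le ?_
    filter_upwards [((Lp.memLp κ).indicator hA).coeFn_toLp] with p hp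
    exact hp ▸ norm_indicator_le_norm_self _ _

lemma coeFn_cutKer {A : Set (ℝ × ℝ)} (hA : MeasurableSet A) (κ : Ker) :
    cutKer A hA κ =ᵐ[(volume : Measure ℝ).prod volume] A.indicator κ :=
  ((Lp.memLp κ).indicator hA).coeFn_toLp

/-- The upper triangular part `κ(x,y) χ_{x < y}` of a kernel. The lower triangular kernels are
those whose upper triangular part vanishes. -/
def upTri : Ker →L[ℝ] Ker := cutKer {p | p.1 < p.2} measurableSet_above

/-- The lower triangular part `κ(x,y) χ_{y < x}` of a kernel. -/
def loTri : Ker →L[ℝ] Ker := cutKer {p | p.2 < p.1} measurableSet_below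

lemma coeFn_upTri (κ : Ker) :
    upTri κ =ᵐ[(volume : Measure ℝ).prod volume] {p : ℝ × ℝ | p.1 < p.2}.indicator κ :=
  coeFn_cutKer _ κ

lemma coeFn_loTri (κ : Ker) :
    loTri κ =ᵐ[(volume : Measure ℝ).prod volume] {p : ℝ × ℝ | p.2 < p.1}.indicator κ :=
  coeFn_cutKer _ κ

lemma ae_fst_ne_snd : ∀ᵐ p ∂((volume : Measure ℝ).prod volume), p.1 ≠ p.2 := by
  refine (Measure.ae_prod_iff_ae_ae
    (measurableSet_eq_fun measurable_fst measurable_snd).compl).2 (ae_of_all _ fun x => ?_)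
  filter_upwards [Measure.ae_ne volume x] with y hy
  exact hy.symm

lemma upTri_add_loTri (κ : Ker) : upTri κ + loTri κ = κ := by
  refine ker_ext ?_
  filter_upwards [Lp.coeFn_add (upTri κ) (loTri κ), coeFn_upTri κ, coeFn_loTri κ, ae_fst_ne_snd]
    with p h1 h2 h3 h4
  rw [h1, Pi.add_apply, h2, h3]
  rcases lt_or_gt_of_ne h4 with h | h
  · simp [h, h.le]
  · simp [h, h.le]

lemma upTri_upTri (κ : Ker) : upTri (upTri κ) = upTri κ := by
  refine ker_ext ?_
  filter_upwards [coeFn_upTri (upTri κ), coeFn_upTri κ] with p h1 h2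
  rw [h1, indicator_apply, h2, indicator_apply]
  split_ifs <;> rfl

lemma upTri_loTri (κ : Ker) : upTri (loTri κ) = 0 := by
  have h := congrArg upTri (upTri_add_loTri κ)
  rwa [map_add, upTri_upTri, add_eq_left] at h

lemma loTri_upTri (κ : Ker) : loTri (upTri κ) = 0 := by
  have h := upTri_add_loTri (upTri κ)
  rwa [upTri_upTri, add_eq_left] at h

lemma loTri_eq_self {κ : Ker} (h : upTri κ = 0) : loTri κ = κ := by
  have := upTri_add_loTri κ
  rwa [h, zero_add] at this

lemma loTri_loTri (κ : Ker) : loTri (loTri κ) = loTri κ := loTri_eq_self (upTri_loTri κ)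

lemma swapKer_upTri (κ : Ker) : swapKer (upTri κ) = loTri (swapKer κ) := by
  refine ker_ext ?_
  filter_upwards [coeFn_swapKer (upTri κ), ae_swap (coeFn_upTri κ), coeFn_loTri (swapKer κ),
    coeFn_swapKer κ] with p h1 h2 h3 h4
  rw [h1, h2, h3]
  by_cases h : p.2 < p.1 <;> simp [h, h4]

lemma swapKer_loTri (κ : Ker) : swapKer (loTri κ) = upTri (swapKer κ) := by
  have := swapKer_upTri (swapKer κ)
  rw [swapKer_swapKer] at this
  rw [← this, swapKer_swapKer]

lemma upTri_eq_zero_iff {κ : Ker} :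
    upTri κ = 0 ↔ ∀ᵐ p ∂((volume : Measure ℝ).prod volume), p.1 < p.2 → κ p = 0 := by
  constructor
  · intro h
    filter_upwards [coeFn_upTri κ, Lp.coeFn_zero ℝ 2 ((volume : Measure ℝ).prod volume)]
      with p h1 h2 h3
    have h4 : ({p : ℝ × ℝ | p.1 < p.2}.indicator κ) p = κ p :=
      indicator_of_mem (s := {p : ℝ × ℝ | p.1 < p.2}) h3 _
    rw [← h4, ← h1, h]
    exact h2
  · intro h
    refine ker_ext ?_
    filter_upwards [coeFn_upTri κ, Lp.coeFn_zero ℝ 2 ((volume : Measure ℝ).prod volume), h]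
      with p h1 h2 h3
    rw [h1]
    refine Eq.trans ?_ h2.symm
    by_cases h : p.1 < p.2
    · simp [h, h3 h]
    · simp [h]

lemma inner_upTri (κ κ' : Ker) : inner ℝ (upTri κ) κ' = inner ℝ κ (upTri κ') := by
  rw [L2.inner_def, L2.inner_def]
  refine integral_congr_ae ?_
  filter_upwards [coeFn_upTri κ, coeFn_upTri κ'] with p h1 h2
  rw [h1, h2]
  by_cases h : p.1 < p.2 <;> simp [h]

/-- The lower triangular kernels form an algebra. -/
lemma upTri_leftMul_eq_zero {a b : Ker} (ha : upTri a = 0) (hb : upTri b = 0) :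
    upTri (leftMul (integralOp a) b) = 0 := by
  rw [upTri_eq_zero_iff] at *
  have h1 := Measure.quasiMeasurePreserving_fst (μ := (volume : Measure ℝ))
    (ν := (volume : Measure ℝ)) |>.ae (Measure.ae_ae_of_ae_prod ha)
  have h2 := Measure.quasiMeasurePreserving_snd (μ := (volume : Measure ℝ))
    (ν := (volume : Measure ℝ)) |>.ae (Measure.ae_ae_of_ae_prod (ae_swap hb))
  filter_upwards [leftMul_integralOp_ae a b, h1, h2] with p h3 h4 h5 h6
  rw [h3]
  refine integral_eq_zero_of_ae ?_
  filter_upwards [h4, h5] with z h7 h8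
  rcases lt_or_ge p.1 z with h | h
  · simp [h7 h]
  · have : b (z, p.2) = 0 := h8 (h.trans_lt h6)
    simp [this]

lemma integralOp_loTri_apply (a : Ker) (φ : H) :
    integralOp (loTri a) φ =ᵐ[volume] fun x => ∫ y in Iio x, a (x, y) * φ y := by
  filter_upwards [integralOp_apply (loTri a) φ, Measure.ae_ae_of_ae_prod (coeFn_loTri a)]
    with x h1 h2
  rw [h1, ← integral_indicator measurableSet_Iio]
  refine integral_congr_ae ?_
  filter_upwards [h2] with y hy
  rw [hy]
  by_cases h : y < x <;> simp [h]

lemma mem_lowerAlgebra_iff {A : Op} :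
    A ∈ lowerAlgebra ↔ ∃ a : Ker, upTri a = 0 ∧ integralOp a = A := by
  constructor
  · rintro ⟨a, ha⟩
    refine ⟨loTri a, upTri_loTri a, ?_⟩
    ext1 φ
    exact Lp.ext ((integralOp_loTri_apply a φ).trans (ha φ).symm)
  · rintro ⟨a, ha, rfl⟩
    refine ⟨a, fun φ => ?_⟩
    have := integralOp_loTri_apply a φ
    rwa [loTri_eq_self ha] at this

/-! ### Volterra operators are quasi-nilpotent -/

/-- The iterated integral that gives the volume of a simplex, for a finite measure without atoms:
`∫_{u < x} μ(-∞,u)ⁿ dμ(u) = μ(-∞,x)ⁿ⁺¹ / (n + 1)`. -/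
lemma lintegral_measure_Iio_pow (μ : Measure ℝ) [IsFiniteMeasure μ] [NullSingletonClass μ] (n : ℕ)
    (x : ℝ) : ((n : ENNReal) + 1) * ∫⁻ u in Iio x, μ (Iio u) ^ n ∂μ = μ (Iio x) ^ (n + 1) := by
  have hM : Measurable fun u => μ (Iio u) :=
    (show Monotone fun u => μ (Iio u) from fun u v h =>
      measure_mono (Iio_subset_Iio h)).measurable
  induction n generalizing x with
  | zero => simp
  | succ n ih =>
    set ν := μ.restrict (Iio x)
    have hν : ∀ u, ν (Iio u) = μ (Iio u ∩ Iio x) := fun u =>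
      Measure.restrict_apply measurableSet_Iio
    -- the square `{u, v < x}` is the union of the triangles `u < v` and `v < u`, up to a null set
    have hsplit : μ (Iio x) * ∫⁻ u in Iio x, μ (Iio u) ^ n ∂μ =
        (∫⁻ v in Iio x, ∫⁻ u in Iio v, μ (Iio u) ^ n ∂μ ∂μ) +
          ∫⁻ u in Iio x, μ (Iio u) ^ (n + 1) ∂μ := by
      have e1 : ∫⁻ v in Iio x, ∫⁻ u in Iio v, μ (Iio u) ^ n ∂μ ∂μ =
          ∫⁻ u, ∫⁻ v, (Ioi u).indicator (fun _ => μ (Iio u) ^ n) v ∂ν ∂ν := by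
        rw [lintegral_lintegral_swap]
        · refine setLIntegral_congr_fun measurableSet_Iio fun v hv => ?_
          have hv' : v < x := hv
          have : Iio v = Iio v ∩ Iio x := by
            rw [Iio_inter_Iio, min_eq_left hv'.le]
          rw [this, ← Measure.restrict_restrict measurableSet_Iio,
            ← lintegral_indicator measurableSet_Iio]
          simp only [indicator, mem_Iio, mem_Ioi, ν]
        · refine Measurable.aemeasurable ?_
          exact Measurable.indicator (f := fun p : ℝ × ℝ => μ (Iio p.1) ^ n)
            ((hM.comp measurable_fst).pow_const n)
              (s := {p : ℝ × ℝ | p.1 < p.2}) measurableSet_above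
      have e2 : ∫⁻ u in Iio x, μ (Iio u) ^ (n + 1) ∂μ =
          ∫⁻ u, ∫⁻ v, (Iio u).indicator (fun _ => μ (Iio u) ^ n) v ∂ν ∂ν := by
        refine setLIntegral_congr_fun measurableSet_Iio fun u hu => ?_
        have hu' : u < x := hu
        rw [lintegral_indicator_const measurableSet_Iio, hν, Iio_inter_Iio, min_eq_left hu'.le,
          pow_succ]
      have e3 : μ (Iio x) * ∫⁻ u in Iio x, μ (Iio u) ^ n ∂μ =
          ∫⁻ u, ∫⁻ _v, μ (Iio u) ^ n ∂ν ∂ν := by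
        simp only [lintegral_const]
        rw [lintegral_mul_const _ (hM.pow_const n), mul_comm]
        simp [ν]
      rw [e1, e2, e3, ← lintegral_add_left]
      · refine lintegral_congr fun u => ?_
        rw [← lintegral_add_left (measurable_const.indicator measurableSet_Ioi)]
        refine lintegral_congr_ae ?_
        have : ∀ᵐ v ∂ν, v ≠ u := ae_restrict_of_ae (Measure.ae_ne μ u)
        filter_upwards [this] with v hv
        rcases lt_or_gt_of_ne hv with h | h
        · simp [h, h.le]
        · simp [h, h.le]
      · simp only [lintegral_indicator_const measurableSet_Ioi]
        refine (hM.pow_const n).mul ?_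
        exact (show Antitone fun u => ν (Ioi u) from fun u v h =>
          measure_mono (Ioi_subset_Ioi h)).measurable
    have hi : ((n : ENNReal) + 1) * ∫⁻ v in Iio x, ∫⁻ u in Iio v, μ (Iio u) ^ n ∂μ ∂μ =
        ∫⁻ v in Iio x, μ (Iio v) ^ (n + 1) ∂μ := by
      rw [← lintegral_const_mul']
      · simp only [ih]
      · finiteness
    have := congrArg (fun r => ((n : ENNReal) + 1) * r) hsplit
    rw [mul_left_comm, ih, mul_add, hi] at this
    rw [pow_succ' _ (n + 1), this]
    push_cast
    ring

lemma sq_lintegral_mul_le {α : Type*} [MeasurableSpace α] (μ : Measure α) {f g : α → ENNReal}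
    (hf : AEMeasurable f μ) (hg : AEMeasurable g μ) :
    (∫⁻ x, f x * g x ∂μ) ^ 2 ≤ (∫⁻ x, f x ^ 2 ∂μ) * ∫⁻ x, g x ^ 2 ∂μ := by
  have h := ENNReal.lintegral_mul_le_Lp_mul_Lq μ Real.HolderConjugate.two_two hf hg
  refine (pow_le_pow_left' h 2).trans (le_of_eq ?_)
  rw [mul_pow, ← ENNReal.rpow_natCast, ← ENNReal.rpow_natCast, ← ENNReal.rpow_mul,
    ← ENNReal.rpow_mul]
  simp

lemma enorm_sq_eq_lintegral {α : Type*} [MeasurableSpace α] {μ : Measure α} (f : Lp ℝ 2 μ) :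
    ‖f‖ₑ ^ 2 = ∫⁻ x, ‖f x‖ₑ ^ 2 ∂μ := by
  have := eLpNorm_nnreal_pow_eq_lintegral (μ := μ) (f := f) (p := 2) (by norm_num)
  rw [Lp.enorm_def]
  simpa using this

lemma measurable_lintegral_sq (a : Ker) : Measurable fun x => ∫⁻ y, ‖a (x, y)‖ₑ ^ 2 := by
  have : Measurable fun p : ℝ × ℝ => ‖a p‖ₑ ^ 2 :=
    (Lp.stronglyMeasurable a).measurable.enorm.pow_const 2
  exact this.lintegral_prod_right'

lemma lintegral_lintegral_sq (a : Ker) : ∫⁻ x, ∫⁻ y, ‖a (x, y)‖ₑ ^ 2 = ‖a‖ₑ ^ 2 := by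
  rw [enorm_sq_eq_lintegral]
  refine (lintegral_prod (fun p : ℝ × ℝ => ‖a p‖ₑ ^ 2) ?_).symm
  exact ((Lp.stronglyMeasurable a).measurable.enorm.pow_const 2).aemeasurable

/-- The Cauchy-Schwarz inequality for a Volterra operator retains the restriction of `φ` to
`(-∞,x)`; iterating it produces the simplex volumes. -/
lemma enorm_volterra_sq_le {a : Ker} (ha : upTri a = 0) (φ : H) :
    ∀ᵐ x : ℝ, ‖integralOp a φ x‖ₑ ^ 2 ≤
      (∫⁻ y, ‖a (x, y)‖ₑ ^ 2) * ∫⁻ y in Iio x, ‖φ y‖ₑ ^ 2 := by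
  have h := integralOp_loTri_apply a φ
  rw [loTri_eq_self ha] at h
  filter_upwards [h] with x hx
  have hm : Measurable fun y => ‖a (x, y)‖ₑ :=
    ((Lp.stronglyMeasurable a).measurable.comp measurable_prodMk_left).enorm
  have hm' : Measurable fun y => ‖φ y‖ₑ := (Lp.stronglyMeasurable φ).measurable.enorm
  rw [hx]
  calc ‖∫ y in Iio x, a (x, y) * φ y‖ₑ ^ 2
      ≤ (∫⁻ y in Iio x, ‖a (x, y)‖ₑ * ‖φ y‖ₑ) ^ 2 := by
        refine pow_le_pow_left' ((enorm_integral_le_lintegral_enorm _).trans_eq ?_) 2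
        simp only [enorm_mul]
    _ ≤ (∫⁻ y in Iio x, ‖a (x, y)‖ₑ ^ 2) * ∫⁻ y in Iio x, ‖φ y‖ₑ ^ 2 :=
        sq_lintegral_mul_le _ hm.aemeasurable hm'.aemeasurable
    _ ≤ _ := by
        gcongr
        exact Measure.restrict_le_self

/-- The powers of a Volterra operator with square integrable kernel decay factorially. -/
lemma factorial_mul_norm_volterra_pow_le {a : Ker} (ha : upTri a = 0) (φ : H) (n : ℕ) :
    (n.factorial : ℝ) * ‖(integralOp a ^ (n + 1)) φ‖ ^ 2 ≤ (‖a‖ ^ 2) ^ (n + 1) * ‖φ‖ ^ 2 := by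
  -- the measure with density `α` has total mass `‖a‖²` and no atoms
  set α : ℝ → ENNReal := fun x => ∫⁻ y, ‖a (x, y)‖ₑ ^ 2 with hα
  have hαm : Measurable α := measurable_lintegral_sq a
  set μ : Measure ℝ := volume.withDensity α
  have hμ : μ univ = ‖a‖ₑ ^ 2 := by
    rw [withDensity_apply _ MeasurableSet.univ, Measure.restrict_univ, hα, lintegral_lintegral_sq]
  have : IsFiniteMeasure μ := ⟨by rw [hμ]; finiteness⟩
  have hM : Measurable fun u => μ (Iio u) :=
    (show Monotone fun u => μ (Iio u) from fun u v h =>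
      measure_mono (Iio_subset_Iio h)).measurable
  have key : ∀ (n : ℕ) (x : ℝ), (n.factorial : ENNReal) *
      ∫⁻ y in Iio x, ‖(integralOp a ^ n) φ y‖ₑ ^ 2 ≤ ‖φ‖ₑ ^ 2 * μ (Iio x) ^ n := by
    intro n
    induction n with
    | zero =>
      intro x
      simp only [Nat.factorial_zero, Nat.cast_one, one_mul, pow_zero, mul_one,
        one_apply_eq_self, enorm_sq_eq_lintegral φ]
      exact lintegral_mono' Measure.restrict_le_self le_rfl
    | succ n ih =>
      intro x
      have h1 : ∫⁻ y in Iio x, ‖(integralOp a ^ (n + 1)) φ y‖ₑ ^ 2 ≤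
          ∫⁻ u in Iio x, α u * ∫⁻ y in Iio u, ‖(integralOp a ^ n) φ y‖ₑ ^ 2 := by
        refine lintegral_mono_ae (ae_restrict_of_ae ?_)
        rw [pow_succ']
        exact enorm_volterra_sq_le ha ((integralOp a ^ n) φ)
      calc ((n + 1).factorial : ENNReal) * ∫⁻ y in Iio x, ‖(integralOp a ^ (n + 1)) φ y‖ₑ ^ 2
          ≤ ((n + 1).factorial : ENNReal) *
            ∫⁻ u in Iio x, α u * ∫⁻ y in Iio u, ‖(integralOp a ^ n) φ y‖ₑ ^ 2 := by gcongr
        _ = ((n : ENNReal) + 1) * ∫⁻ u in Iio x,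
            α u * (n.factorial * ∫⁻ y in Iio u, ‖(integralOp a ^ n) φ y‖ₑ ^ 2) := by
          rw [Nat.factorial_succ]
          push_cast
          rw [mul_assoc, ← lintegral_const_mul' _ _ (by finiteness)]
          simp only [mul_left_comm]
        _ ≤ ((n : ENNReal) + 1) * ∫⁻ u in Iio x, α u * (‖φ‖ₑ ^ 2 * μ (Iio u) ^ n) := by
          gcongr _ * ∫⁻ u in Iio x, α u * ?_ with u
          exact ih u
        _ = ‖φ‖ₑ ^ 2 * (((n : ENNReal) + 1) * ∫⁻ u in Iio x, μ (Iio u) ^ n ∂μ) := by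
          rw [setLIntegral_withDensity_eq_setLIntegral_mul _ hαm (hM.pow_const n)
            measurableSet_Iio, mul_left_comm (‖φ‖ₑ ^ 2),
            ← lintegral_const_mul' (‖φ‖ₑ ^ 2) _ (by finiteness)]
          simp only [Pi.mul_apply, mul_left_comm]
        _ = ‖φ‖ₑ ^ 2 * μ (Iio x) ^ (n + 1) := by rw [lintegral_measure_Iio_pow]
  have hE : (n.factorial : ENNReal) * ‖(integralOp a ^ (n + 1)) φ‖ₑ ^ 2 ≤
      (‖a‖ₑ ^ 2) ^ (n + 1) * ‖φ‖ₑ ^ 2 := by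
    calc (n.factorial : ENNReal) * ‖(integralOp a ^ (n + 1)) φ‖ₑ ^ 2
        ≤ n.factorial * ∫⁻ u, α u * ∫⁻ y in Iio u, ‖(integralOp a ^ n) φ y‖ₑ ^ 2 := by
          rw [enorm_sq_eq_lintegral, pow_succ']
          gcongr _ * ?_
          exact lintegral_mono_ae (enorm_volterra_sq_le ha ((integralOp a ^ n) φ))
      _ = ∫⁻ u, α u * (n.factorial * ∫⁻ y in Iio u, ‖(integralOp a ^ n) φ y‖ₑ ^ 2) := by
          rw [← lintegral_const_mul' _ _ (by finiteness)]
          simp only [mul_left_comm]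
      _ ≤ ∫⁻ u, α u * (‖φ‖ₑ ^ 2 * μ univ ^ n) := by
          gcongr ∫⁻ u, α u * ?_ with u
          refine (key n u).trans ?_
          gcongr
          exact subset_univ _
      _ = (‖a‖ₑ ^ 2) ^ (n + 1) * ‖φ‖ₑ ^ 2 := by
          rw [lintegral_mul_const _ hαm, hα, lintegral_lintegral_sq, hμ]
          ring
  have := ENNReal.toReal_mono (by finiteness) hE
  simpa using this

lemma summable_norm_volterra_pow {a : Ker} (ha : upTri a = 0) :
    Summable fun n => ‖integralOp a ^ n‖ := by
  rw [← summable_nat_add_iff 1]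
  set Q := ‖a‖ ^ 2
  refine Summable.of_nonneg_of_le (fun _ => norm_nonneg _) (fun n => ?_)
    (((Real.summable_pow_div_factorial (4 * Q)).mul_left Q).add
      (summable_geometric_of_lt_one (r := (1 / 4 : ℝ)) (by norm_num) (by norm_num)))
  refine ContinuousLinearMap.opNorm_le_bound _ (by positivity) fun φ => ?_
  refine le_of_sq_le_sq ?_ (by positivity)
  have h := factorial_mul_norm_volterra_pow_le ha φ n
  have hf : (0 : ℝ) < n.factorial := by positivity
  rw [mul_comm, ← le_div_iff₀ hf] at h
  refine h.trans ?_
  rw [mul_pow, mul_div_right_comm]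
  gcongr
  -- the product of two numbers is at most the square of their sum
  have e : Q ^ (n + 1) / n.factorial = (Q * ((4 * Q) ^ n / n.factorial)) * (1 / 4 : ℝ) ^ n := by
    rw [mul_pow, pow_succ, div_pow, one_pow]
    field_simp
  rw [e]
  have h1 : 0 ≤ Q * ((4 * Q) ^ n / n.factorial) := by positivity
  have h2 : (0 : ℝ) ≤ (1 / 4) ^ n := by positivity
  nlinarith [mul_nonneg h1 h2, sq_nonneg (Q * ((4 * Q) ^ n / n.factorial)),
    sq_nonneg ((1 / 4 : ℝ) ^ n)]

/-- The group `I + 𝔩` is closed under inversion, and all operators `I + A`, `A ∈ 𝔩`, are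
invertible: the Neumann series converges. -/
lemma exists_lower_inverse {a : Ker} (ha : upTri a = 0) :
    ∃ a' : Ker, upTri a' = 0 ∧ (1 + integralOp a) * (1 + integralOp a') = 1 ∧
      (1 + integralOp a') * (1 + integralOp a) = 1 := by
  set A := integralOp a
  have hs : Summable fun n => (-A) ^ n := by
    refine Summable.of_norm ((summable_norm_volterra_pow ha).congr fun n => ?_)
    rcases Nat.even_or_odd n with h | h
    · rw [h.neg_pow]
    · rw [h.neg_pow, norm_neg]
  set X := ∑' n, (-A) ^ n
  have h1 : (1 + A) * X = 1 := by
    have := hs.one_sub_mul_tsum_pow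
    rwa [sub_neg_eq_add] at this
  have h2 : X * (1 + A) = 1 := by
    have := hs.tsum_pow_mul_one_sub
    rwa [sub_neg_eq_add] at this
  have h3 : 1 + integralOp (-leftMul X a) = X := by
    rw [integralOp_neg, integralOp_leftMul, ← h2]
    simp only [A]
    noncomm_ring
  refine ⟨-leftMul X a, ?_, by rw [h3, h1], by rw [h3, h2]⟩
  rw [map_neg, neg_eq_zero]
  have h4 : ∀ n, upTri (leftMul ((-A) ^ n) a) = 0 := by
    intro n
    induction n with
    | zero => rw [pow_zero, leftMul_one, ha]
    | succ n ih =>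
      rw [pow_succ', leftMul_mul, map_neg, neg_apply, map_neg, upTri_leftMul_eq_zero ha ih,
        neg_zero]
  have h5 := ((upTri ∘L leftMul.flip a).hasSum hs.hasSum)
  simp only [ContinuousLinearMap.comp_apply, ContinuousLinearMap.flip_apply, h4] at h5
  exact h5.unique hasSum_zero

/-! ### The factorization problem -/

lemma one_add_integralOp_mul (a b : Ker) :
    (1 + integralOp a) * (1 + integralOp b) =
      1 + integralOp (a + b + leftMul (integralOp a) b) := by
  rw [integralOp_add, integralOp_add, integralOp_leftMul]
  noncomm_ring

lemma star_one_add_integralOp (a : Ker) :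
    star (1 + integralOp a) = 1 + integralOp (swapKer a) := by
  rw [star_add, star_one, integralOp_swapKer]

lemma one_add_integralOp_injective : Function.Injective fun a : Ker => (1 : Op) + integralOp a :=
  fun _ _ h => integralOp_injective (add_left_cancel h)

lemma upTri_one_add_mul {a b : Ker} (ha : upTri a = 0) (hb : upTri b = 0) :
    upTri (a + b + leftMul (integralOp a) b) = 0 := by
  rw [map_add, map_add, ha, hb, upTri_leftMul_eq_zero ha hb, add_zero, add_zero]

/-- A kernel that is both lower and upper triangular vanishes. -/
lemma eq_zero_of_upTri_eq_zero {a : Ker} (ha : upTri a = 0) (ha' : upTri (swapKer a) = 0) :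
    a = 0 := by
  rw [← swapKer_loTri, loTri_eq_self ha] at ha'
  rw [← swapKer_swapKer a, ha', map_zero]

/-- The compression `κ ↦ P (T κ)` to the space of upper triangular kernels (with projection `P`)
of the left multiplication by `T`, extended to all kernels by the identity on lower triangular
ones. -/
def upCompression (T : Op) : Ker →L[ℝ] Ker := upTri ∘L leftMul T ∘L upTri + loTri

lemma upCompression_apply (T : Op) (κ : Ker) :
    upCompression T κ = upTri (leftMul T (upTri κ)) + loTri κ := rfl

lemma inner_upTri_loTri (κ κ' : Ker) : inner ℝ (upTri κ) (loTri κ') = 0 := by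
  rw [inner_upTri, upTri_loTri, inner_zero_right]

lemma norm_sq_eq_upTri_add_loTri (κ : Ker) : ‖κ‖ ^ 2 = ‖upTri κ‖ ^ 2 + ‖loTri κ‖ ^ 2 := by
  have h := norm_add_sq_real (upTri κ) (loTri κ)
  rw [upTri_add_loTri, inner_upTri_loTri] at h
  linarith

lemma inner_loTri_self (κ : Ker) : inner ℝ (loTri κ) κ = ‖loTri κ‖ ^ 2 := by
  have h : inner ℝ (loTri κ) κ = inner ℝ (loTri κ) (upTri κ + loTri κ) := by
    rw [upTri_add_loTri]
  rw [h, inner_add_right, real_inner_comm, inner_upTri_loTri, real_inner_self_eq_norm_sq, zero_add]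

/-- Left multiplication by `g g*` is positive definite, hence so is its compression to the upper
triangular kernels, which is therefore invertible (Lax-Milgram). -/
lemma isUnit_upCompression (g : Opˣ) : IsUnit (upCompression ((g : Op) * star (g : Op))) := by
  set r := ‖star ((g⁻¹ : Opˣ) : Op)‖ + 1 with hr
  have hr0 : 0 < r := by positivity
  have hr1 : 1 ≤ r := by rw [hr]; linarith [norm_nonneg (star ((g⁻¹ : Opˣ) : Op))]
  have hc : 0 < (r ^ 2)⁻¹ := by positivity
  refine ContinuousLinearMap.isUnit_of_forall_le_norm_inner_map _
    (c := ⟨(r ^ 2)⁻¹, hc.le⟩) hc fun κ => ?_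
  change ‖κ‖ ^ 2 * (r ^ 2)⁻¹ ≤ _
  have h1 : inner ℝ (upCompression ((g : Op) * star (g : Op)) κ) κ =
      ‖leftMul (star (g : Op)) (upTri κ)‖ ^ 2 + ‖loTri κ‖ ^ 2 := by
    rw [upCompression_apply, inner_add_left, inner_upTri, leftMul_mul, inner_leftMul,
      real_inner_self_eq_norm_sq, inner_loTri_self]
  have h2 : ‖upTri κ‖ ≤ r * ‖leftMul (star (g : Op)) (upTri κ)‖ := by
    calc ‖upTri κ‖ = ‖leftMul (star ((g⁻¹ : Opˣ) : Op)) (leftMul (star (g : Op)) (upTri κ))‖ := by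
          rw [← leftMul_mul, ← star_mul, Units.mul_inv, star_one, leftMul_one]
      _ ≤ ‖star ((g⁻¹ : Opˣ) : Op)‖ * ‖leftMul (star (g : Op)) (upTri κ)‖ := norm_leftMul_le _ _
      _ ≤ _ := by gcongr; rw [hr]; linarith
  rw [h1, Real.norm_of_nonneg (by positivity), norm_sq_eq_upTri_add_loTri, ← div_eq_mul_inv,
    div_le_iff₀ (by positivity), add_mul]
  have h3 : ‖upTri κ‖ ^ 2 ≤ ‖leftMul (star (g : Op)) (upTri κ)‖ ^ 2 * r ^ 2 := by
    rw [← mul_pow, mul_comm]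
    gcongr
  have h4 : 1 ≤ r ^ 2 := one_le_pow₀ hr1
  nlinarith [sq_nonneg ‖loTri κ‖]

/-- The solution `C` in upper triangular kernels of the equation `P (C + S C) = - P S`, where `P`
is the projection onto the upper triangular kernels. -/
def resolventKer (S : Ker) : Ker := -(Ring.inverse (upCompression (1 + integralOp S)) (upTri S))

/-- The kernel of `(I + S)(I + C) - I`, where `C` is the resolvent kernel. -/
def lowerFactor (S : Ker) : Ker := S + leftMul (1 + integralOp S) (resolventKer S)

lemma one_add_lowerFactor (S : Ker) :
    1 + integralOp (lowerFactor S) = (1 + integralOp S) * (1 + integralOp (resolventKer S)) := by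
  rw [lowerFactor, integralOp_add, integralOp_leftMul]
  noncomm_ring

lemma upCompression_resolventKer {S : Ker} (hS : IsUnit (upCompression (1 + integralOp S))) :
    upCompression (1 + integralOp S) (resolventKer S) = -upTri S := by
  have := Ring.mul_inverse_cancel _ hS
  rw [resolventKer, map_neg, ← mul_apply_eq_comp, this, one_apply_eq_self]

lemma loTri_resolventKer {S : Ker} (hS : IsUnit (upCompression (1 + integralOp S))) :
    loTri (resolventKer S) = 0 := by
  have h := congrArg loTri (upCompression_resolventKer hS)
  rwa [upCompression_apply, map_add, loTri_upTri, loTri_loTri, zero_add, map_neg, loTri_upTri,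
    neg_zero] at h

lemma upTri_swapKer_resolventKer {S : Ker} (hS : IsUnit (upCompression (1 + integralOp S))) :
    upTri (swapKer (resolventKer S)) = 0 := by
  rw [← swapKer_loTri, loTri_resolventKer hS, map_zero]

lemma upTri_lowerFactor {S : Ker} (hS : IsUnit (upCompression (1 + integralOp S))) :
    upTri (lowerFactor S) = 0 := by
  have h := upCompression_resolventKer hS
  have h1 := upTri_add_loTri (resolventKer S)
  rw [loTri_resolventKer hS, add_zero] at h1
  rw [upCompression_apply, loTri_resolventKer hS, add_zero, h1] at h
  rw [lowerFactor, map_add, h, add_neg_cancel]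

/-- The operator `(I + C*)(I + S)(I + C)` is lower triangular with unit diagonal and symmetric, so
it is the identity. -/
lemma resolvent_mul_lowerFactor {S : Ker} (hS : IsUnit (upCompression (1 + integralOp S)))
    (hsymm : swapKer S = S) :
    (1 + integralOp (swapKer (resolventKer S))) * (1 + integralOp (lowerFactor S)) = 1 := by
  set a := swapKer (resolventKer S) with ha
  set w := a + lowerFactor S + leftMul (integralOp a) (lowerFactor S) with hw
  have h1 : (1 + integralOp a) * (1 + integralOp (lowerFactor S)) = 1 + integralOp w :=
    one_add_integralOp_mul _ _
  have h2 : upTri w = 0 := upTri_one_add_mul (upTri_swapKer_resolventKer hS) (upTri_lowerFactor hS)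
  have h3 : 1 + integralOp (swapKer w) = 1 + integralOp w := by
    rw [← star_one_add_integralOp, ← h1, one_add_lowerFactor, star_mul, star_mul,
      star_one_add_integralOp, star_one_add_integralOp, star_one_add_integralOp, hsymm, ha,
      swapKer_swapKer, mul_assoc]
  have h4 : swapKer w = w := one_add_integralOp_injective h3
  rw [h1, eq_zero_of_upTri_eq_zero h2 (by rw [h4, h2]), integralOp_zero, add_zero]

lemma lowerFactor_mul_resolvent {S : Ker} (hS : IsUnit (upCompression (1 + integralOp S)))
    (hsymm : swapKer S = S) :
    (1 + integralOp (lowerFactor S)) * (1 + integralOp (swapKer (resolventKer S))) = 1 := by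
  obtain ⟨b, -, -, h2⟩ := exists_lower_inverse (upTri_swapKer_resolventKer hS)
  have h := resolvent_mul_lowerFactor hS hsymm
  rw [← left_inv_eq_right_inv h2 h, h2]

lemma lowerFactor_mul_star {S : Ker} (hS : IsUnit (upCompression (1 + integralOp S)))
    (hsymm : swapKer S = S) :
    (1 + integralOp (lowerFactor S)) * star (1 + integralOp (lowerFactor S)) =
      1 + integralOp S := by
  have h : 1 + integralOp (resolventKer S) =
      star (1 + integralOp (swapKer (resolventKer S))) := by
    rw [star_one_add_integralOp, swapKer_swapKer]
  nth_rewrite 1 [one_add_lowerFactor]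
  rw [h, mul_assoc, ← star_mul, lowerFactor_mul_resolvent hS hsymm, star_one, mul_one]

/-- The lower triangular factor as an invertible operator. -/
def lowerUnit {S : Ker} (hS : IsUnit (upCompression (1 + integralOp S)))
    (hsymm : swapKer S = S) : Opˣ where
  val := 1 + integralOp (lowerFactor S)
  inv := 1 + integralOp (swapKer (resolventKer S))
  val_inv := lowerFactor_mul_resolvent hS hsymm
  inv_val := resolvent_mul_lowerFactor hS hsymm

lemma swapKer_eq_of_mul_star {S : Ker} {g : Op} (hS : 1 + integralOp S = g * star g) :
    swapKer S = S := by
  refine one_add_integralOp_injective ?_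
  simp only
  rw [← star_one_add_integralOp, hS, star_mul, star_star]

lemma isFactorization_lowerUnit {g : Opˣ} {E S : Ker} (hE : (g : Op) = 1 + integralOp E)
    (hg : 1 + integralOp S = (g : Op) * star (g : Op))
    (hS : IsUnit (upCompression (1 + integralOp S))) :
    IsFactorization g (lowerUnit hS (swapKer_eq_of_mul_star hg))
      (g⁻¹ * lowerUnit hS (swapKer_eq_of_mul_star hg)) := by
  have hsymm := swapKer_eq_of_mul_star hg
  set b := lowerUnit hS hsymm with hb
  have hbv : (b : Op) = 1 + integralOp (lowerFactor S) := rfl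
  refine ⟨?_, ⟨?_, ?_⟩, ?_⟩
  · change (b : Op) - 1 ∈ lowerAlgebra
    rw [mem_lowerAlgebra_iff]
    exact ⟨lowerFactor S, upTri_lowerFactor hS, by rw [hbv, add_sub_cancel_left]⟩
  · change IsHilbertSchmidt _
    refine isHilbertSchmidt_iff.2
      ⟨leftMul ((g⁻¹ : Opˣ) : Op) (lowerFactor S - E), ?_⟩
    have : integralOp (lowerFactor S - E) = b - g := by
      rw [hbv, hE, integralOp_sub, add_sub_add_left_eq_sub]
    rw [integralOp_leftMul, this, mul_sub, Units.inv_mul, Units.val_mul]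
  · have h1 : ((g⁻¹ * b : Opˣ) : Op) * star ((g⁻¹ * b : Opˣ) : Op) = 1 := by
      have h2 : (b : Op) * star (b : Op) = g * star (g : Op) :=
        (lowerFactor_mul_star hS hsymm).trans hg
      calc ((g⁻¹ * b : Opˣ) : Op) * star ((g⁻¹ * b : Opˣ) : Op)
          = ((g⁻¹ : Opˣ) : Op) * ((b : Op) * star (b : Op)) * star ((g⁻¹ : Opˣ) : Op) := by
            rw [Units.val_mul, star_mul]; noncomm_ring
        _ = (((g⁻¹ : Opˣ) : Op) * g) * (star (g : Op) * star ((g⁻¹ : Opˣ) : Op)) := by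
            rw [h2]; noncomm_ring
        _ = 1 := by rw [Units.inv_mul, ← star_mul, Units.inv_mul, star_one, mul_one]
    refine ⟨h1, ?_⟩
    have h3 : star ((g⁻¹ * b : Opˣ) : Op) = (((g⁻¹ * b)⁻¹ : Opˣ) : Op) :=
      (Units.inv_eq_of_mul_eq_one_right h1).symm
    rw [← ContinuousLinearMap.star_eq_adjoint, h3, Units.inv_mul]
  · rw [← Units.val_mul]
    congr 1
    group

lemma IsFactorization.mul_star {g : Op} {bm bp : Opˣ} (h : IsFactorization g bm bp) :
    (bm : Op) * star (bm : Op) = g * star g := by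
  obtain ⟨-, ⟨-, h1, h2⟩, h3⟩ := h
  rw [← ContinuousLinearMap.star_eq_adjoint] at h1 h2
  have h4 : (bm : Op) = g * bp := by rw [h3, mul_assoc, Units.inv_mul, mul_one]
  rw [h4, star_mul, mul_assoc, ← mul_assoc (bp : Op), h1, one_mul]

/-- The factorization is unique, because `𝓛 ∩ 𝓚` is trivial. -/
lemma IsFactorization.unique {g : Op} {bm bp bm' bp' : Opˣ} (h : IsFactorization g bm bp)
    (h' : IsFactorization g bm' bp') : bm = bm' ∧ bp = bp' := by
  have key : bm = bm' := by
    obtain ⟨d, hd, hd'⟩ := mem_lowerAlgebra_iff.1 h.1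
    obtain ⟨c, hc, hc'⟩ := mem_lowerAlgebra_iff.1 h'.1
    have ed : (bm : Op) = 1 + integralOp d := by rw [hd', add_sub_cancel]
    have ec : (bm' : Op) = 1 + integralOp c := by rw [hc', add_sub_cancel]
    obtain ⟨a, ha, ha1, ha2⟩ := exists_lower_inverse hc
    obtain ⟨e, he, he1, he2⟩ := exists_lower_inverse hd
    set w := a + d + leftMul (integralOp a) d
    have hw : upTri w = 0 := upTri_one_add_mul ha hd
    set v := e + c + leftMul (integralOp e) c
    have hv : upTri v = 0 := upTri_one_add_mul he hc
    have e1 : (1 + integralOp a) * bm = 1 + integralOp w := by rw [ed, one_add_integralOp_mul]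
    have e2 : (1 + integralOp e) * bm' = 1 + integralOp v := by rw [ec, one_add_integralOp_mul]
    have h1 : (1 + integralOp v) * (1 + integralOp w) = 1 := by
      rw [← e1, ← e2, ec, ed]
      calc _ = (1 + integralOp e) * ((1 + integralOp c) * (1 + integralOp a)) *
            (1 + integralOp d) := by noncomm_ring
        _ = 1 := by rw [ha1, mul_one, he2]
    have h2 : (1 + integralOp w) * star (1 + integralOp w) = 1 := by
      have h3 : (bm : Op) * star (bm : Op) = bm' * star (bm' : Op) :=
        h.mul_star.trans h'.mul_star.symm
      rw [← e1, star_mul]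
      calc _ = (1 + integralOp a) * ((bm : Op) * star (bm : Op)) * star (1 + integralOp a) := by
            noncomm_ring
        _ = ((1 + integralOp a) * bm') * star ((1 + integralOp a) * (bm' : Op)) := by
            rw [h3, star_mul]; noncomm_ring
        _ = 1 := by rw [ec, ha2, star_one, mul_one]
    have h4 : swapKer w = v := by
      refine one_add_integralOp_injective ?_
      simp only
      rw [← star_one_add_integralOp, left_inv_eq_right_inv h1 h2]
    have h5 : w = 0 := eq_zero_of_upTri_eq_zero hw (by rw [h4, hv])
    rw [h5, integralOp_zero, add_zero] at e1
    refine Units.ext ?_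
    calc (bm : Op) = (bm' : Op) * ((1 + integralOp a) * bm) := by
          rw [← mul_assoc, ec, ha1, one_mul]
      _ = bm' := by rw [e1, mul_one]
  refine ⟨key, ?_⟩
  have h1 : (bm : Op) * ((bp⁻¹ : Opˣ) : Op) = bm * ((bp'⁻¹ : Opˣ) : Op) := by
    rw [← h.2.2, h'.2.2, key]
  rw [← Units.val_mul, ← Units.val_mul] at h1
  exact inv_injective (mul_left_cancel (Units.ext h1))

/-! ### The projections onto the triangular and the skew-symmetric part -/

lemma kerL_eq (κ : Ker) : kerL κ = loTri (κ + swapKer κ) := by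
  refine ker_ext ?_
  have h : kerL κ =ᵐ[(volume : Measure ℝ).prod volume]
      {p : ℝ × ℝ | p.2 < p.1}.indicator ((fun p => κ p) + fun p => κ p.swap) :=
    MemLp.coeFn_toLp _
  filter_upwards [h, coeFn_loTri (κ + swapKer κ), Lp.coeFn_add κ (swapKer κ), coeFn_swapKer κ]
    with p h1 h2 h3 h4
  rw [h1, h2, indicator_apply, indicator_apply, h3, Pi.add_apply, Pi.add_apply, h4]

lemma kerK_eq (κ : Ker) : kerK κ = upTri κ - loTri (swapKer κ) := by
  refine ker_ext ?_
  have h : kerK κ =ᵐ[(volume : Measure ℝ).prod volume]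
      {p : ℝ × ℝ | p.1 < p.2}.indicator (fun p => κ p) -
      {p : ℝ × ℝ | p.2 < p.1}.indicator fun p => κ p.swap :=
    MemLp.coeFn_toLp _
  filter_upwards [h, coeFn_loTri (swapKer κ), coeFn_upTri κ,
    Lp.coeFn_sub (upTri κ) (loTri (swapKer κ)), coeFn_swapKer κ] with p h1 h2 h3 h4 h5
  rw [h1, h4, Pi.sub_apply, Pi.sub_apply, h2, h3, indicator_apply {p : ℝ × ℝ | p.2 < p.1},
    indicator_apply {p : ℝ × ℝ | p.2 < p.1}, h5]

lemma kerL_add_kerK (κ : Ker) : kerL κ + kerK κ = κ := by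
  calc kerL κ + kerK κ = upTri κ + loTri κ := by
        rw [kerL_eq, kerK_eq, map_add]
        abel
    _ = κ := upTri_add_loTri κ

/-- `projL` is the projection onto the lower triangular part along the skew-symmetric operators. -/
lemma kerL_add_of_skew {l n : Ker} (hl : upTri l = 0) (hn : swapKer n = -n) :
    kerL (l + n) = l := by
  have h : l + n + swapKer (l + n) = l + swapKer l := by
    rw [map_add, hn]
    abel
  rw [kerL_eq, h, map_add, loTri_eq_self hl, ← swapKer_upTri, hl, map_zero, add_zero]

lemma projL_add_projK {K : Op} (hK : IsHilbertSchmidt K) : projL K + projK K = K := by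
  rw [projL, projK, ← integralOp_add, kerL_add_kerK, integralOp_kernel hK]

/-! ### Differentiability of the factors -/

/-- The kernel of `exp (t X) - I`, for `X` the integral operator with kernel `ξ`, obtained by
integrating the differential equation of the exponential. -/
def expKer (ξ : Ker) (t : ℝ) : Ker :=
  ∫ r in (0 : ℝ)..t, leftMul (NormedSpace.exp (r • integralOp ξ)) ξ

lemma hasDerivAt_exp_integralOp (ξ : Ker) (t : ℝ) :
    HasDerivAt (fun r : ℝ => NormedSpace.exp (r • integralOp ξ))
      (NormedSpace.exp (t • integralOp ξ) * integralOp ξ) t :=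
  hasDerivAt_exp_smul_const (integralOp ξ) t

lemma hasDerivAt_expKer (ξ : Ker) (t : ℝ) :
    HasDerivAt (expKer ξ) (leftMul (NormedSpace.exp (t • integralOp ξ)) ξ) t := by
  have hc : Continuous fun r : ℝ => NormedSpace.exp (r • integralOp ξ) :=
    continuous_iff_continuousAt.2 fun r => (hasDerivAt_exp_integralOp ξ r).continuousAt
  have hc' : Continuous fun r : ℝ => leftMul (NormedSpace.exp (r • integralOp ξ)) ξ :=
    (leftMul.flip ξ).continuous.comp hc
  exact (hc'.integral_hasStrictDerivAt 0 t).hasDerivAt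

lemma hasDerivAt_integralOp {κ : ℝ → Ker} {D : Ker} {t : ℝ} (h : HasDerivAt κ D t) :
    HasDerivAt (fun s => integralOp (κ s)) (integralOp D) t :=
  integralOpL.hasFDerivAt.comp_hasDerivAt t h

lemma one_add_expKer (ξ : Ker) (t : ℝ) :
    1 + integralOp (expKer ξ t) = NormedSpace.exp (t • integralOp ξ) := by
  have hd : ∀ s, HasDerivAt
      (fun s => 1 + integralOp (expKer ξ s) - NormedSpace.exp (s • integralOp ξ)) 0 s := by
    intro s
    have := ((hasDerivAt_integralOp (hasDerivAt_expKer ξ s)).const_add 1).sub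
      (hasDerivAt_exp_integralOp ξ s)
    rwa [integralOp_leftMul, sub_self] at this
  have h := is_const_of_deriv_eq_zero (fun s => (hd s).differentiableAt) (fun s => (hd s).deriv) t 0
  have h0 : expKer ξ 0 = 0 := intervalIntegral.integral_same
  rw [zero_smul, NormedSpace.exp_zero, h0, integralOp_zero, add_zero, sub_self] at h
  exact sub_eq_zero.1 h

/-- The kernel of `g g* - I`, for `g = exp (t X)`. -/
def gramKer (ξ : Ker) (t : ℝ) : Ker :=
  expKer ξ t + swapKer (expKer ξ t) + leftMul (integralOp (expKer ξ t)) (swapKer (expKer ξ t))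

lemma one_add_gramKer (ξ : Ker) (t : ℝ) :
    1 + integralOp (gramKer ξ t) =
      NormedSpace.exp (t • integralOp ξ) * star (NormedSpace.exp (t • integralOp ξ)) := by
  rw [gramKer, ← one_add_integralOp_mul, ← star_one_add_integralOp, one_add_expKer]

lemma isUnit_exp_op (X : Op) : IsUnit (NormedSpace.exp X) :=
  let _ := NormedAlgebra.restrictScalars ℚ ℝ Op
  NormedSpace.isUnit_exp X

/-- The exponential `exp (t X)` as an invertible operator. -/
def expUnit (ξ : Ker) (t : ℝ) : Opˣ := (isUnit_exp_op (t • integralOp ξ)).unit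

lemma coe_expUnit (ξ : Ker) (t : ℝ) :
    (expUnit ξ t : Op) = NormedSpace.exp (t • integralOp ξ) := rfl

lemma isUnit_upCompression_gramKer (ξ : Ker) (t : ℝ) :
    IsUnit (upCompression (1 + integralOp (gramKer ξ t))) := by
  rw [one_add_gramKer, ← coe_expUnit]
  exact isUnit_upCompression _

lemma swapKer_gramKer (ξ : Ker) (t : ℝ) : swapKer (gramKer ξ t) = gramKer ξ t :=
  swapKer_eq_of_mul_star (one_add_gramKer ξ t)

lemma differentiable_leftMul_apply {T : ℝ → Op} {κ : ℝ → Ker} (hT : Differentiable ℝ T)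
    (hκ : Differentiable ℝ κ) : Differentiable ℝ fun t => leftMul (T t) (κ t) :=
  (leftMul.differentiable.comp hT).clm_apply hκ

lemma differentiable_integralOp {κ : ℝ → Ker} (hκ : Differentiable ℝ κ) :
    Differentiable ℝ fun t => integralOp (κ t) :=
  integralOpL.differentiable.comp hκ

lemma differentiable_gramKer (ξ : Ker) : Differentiable ℝ (gramKer ξ) := by
  have h1 : Differentiable ℝ (expKer ξ) := fun t => (hasDerivAt_expKer ξ t).differentiableAt
  have h2 : Differentiable ℝ fun t => swapKer (expKer ξ t) := swapKer.differentiable.comp h1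
  exact (h1.add h2).add (differentiable_leftMul_apply (differentiable_integralOp h1) h2)

/-- The resolvent kernel depends differentiably on the parameter, since it solves a linear equation
with differentiable coefficients. -/
lemma differentiable_resolventKer {S : ℝ → Ker} (hS : Differentiable ℝ S)
    (hu : ∀ t, IsUnit (upCompression (1 + integralOp (S t)))) :
    Differentiable ℝ fun t => resolventKer (S t) := by
  intro t
  have h1 : Differentiable ℝ fun t => upCompression (1 + integralOp (S t)) := by
    have h2 : Differentiable ℝ fun t => leftMul (1 + integralOp (S t)) :=
      leftMul.differentiable.comp ((differentiable_integralOp hS).const_add 1)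
    exact ((differentiable_const upTri).clm_comp
      (h2.clm_comp (differentiable_const upTri))).add_const loTri
  have h3 : DifferentiableAt ℝ
      (fun t => Ring.inverse (upCompression (1 + integralOp (S t)))) t := by
    have h4 := hasFDerivAt_ringInverse (𝕜 := ℝ) (hu t).unit
    rw [IsUnit.unit_spec] at h4
    exact DifferentiableAt.comp t h4.differentiableAt (h1 t)
  exact (h3.clm_apply (upTri.differentiable.comp hS t)).neg

lemma differentiable_lowerFactor {S : ℝ → Ker} (hS : Differentiable ℝ S)
    (hu : ∀ t, IsUnit (upCompression (1 + integralOp (S t)))) :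
    Differentiable ℝ fun t => lowerFactor (S t) :=
  hS.add (differentiable_leftMul_apply ((differentiable_integralOp hS).const_add 1)
    (differentiable_resolventKer hS hu))

/-! ### The Lax equation -/

/-- The kernel of `K(t) = b₋(t)⁻¹ K₀ b₋(t)`, where `b₋(t)` is the lower triangular factor of
`exp (t X)` and `X` and `K₀` are the integral operators with kernels `ξ` and `κ₀`. -/
def laxKer (ξ κ₀ : Ker) (t : ℝ) : Ker :=
  leftMul (1 + integralOp (swapKer (resolventKer (gramKer ξ t))))
    (κ₀ + leftMul (integralOp κ₀) (lowerFactor (gramKer ξ t)))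

lemma integralOp_laxKer (ξ κ₀ : Ker) (t : ℝ) :
    integralOp (laxKer ξ κ₀ t) =
      (1 + integralOp (swapKer (resolventKer (gramKer ξ t)))) * integralOp κ₀ *
        (1 + integralOp (lowerFactor (gramKer ξ t))) := by
  rw [laxKer, integralOp_leftMul, integralOp_add, integralOp_leftMul]
  noncomm_ring

lemma differentiable_laxKer (ξ κ₀ : Ker) : Differentiable ℝ (laxKer ξ κ₀) := by
  have h1 := differentiable_resolventKer (differentiable_gramKer ξ) (isUnit_upCompression_gramKer ξ)
  have h2 := differentiable_lowerFactor (differentiable_gramKer ξ) (isUnit_upCompression_gramKer ξ)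
  exact differentiable_leftMul_apply
    ((differentiable_integralOp (swapKer.differentiable.comp h1)).const_add 1)
    ((differentiable_leftMul_apply (differentiable_const _) h2).const_add κ₀)

lemma upTri_eq_zero_of_hasDerivAt {d : ℝ → Ker} {d' : Ker} {t : ℝ} (h : HasDerivAt d d' t)
    (h0 : ∀ s, upTri (d s) = 0) : upTri d' = 0 := by
  have h1 := upTri.hasFDerivAt.comp_hasDerivAt t h
  have h2 : (upTri ∘ d) = fun _ => 0 := funext h0
  rw [h2] at h1
  exact h1.unique (hasDerivAt_const t 0)

/-- Writing `b` for the lower triangular factor of `g = exp (t X)` and `M = b⁻¹ ḃ`, the derivative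
of `b⁻¹ K₀ b` is its commutator with `M`. Here `M` is lower triangular, while differentiating
`b b* = g g*` shows that `b⁻¹ X b - M` is skew-symmetric. -/
lemma exists_hasDerivAt_laxKer (ξ κ₀ : Ker) (t : ℝ) :
    ∃ m D : Ker, upTri m = 0 ∧ swapKer (laxKer ξ ξ t - m) = -(laxKer ξ ξ t - m) ∧
      HasDerivAt (laxKer ξ κ₀) D t ∧
      integralOp D = ⁅integralOp (laxKer ξ κ₀ t), integralOp m⁆ := by
  set S := gramKer ξ
  have hu := isUnit_upCompression_gramKer ξ
  set d : ℝ → Ker := fun s => lowerFactor (S s) with hd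
  set a : ℝ → Ker := fun s => swapKer (resolventKer (S s)) with ha
  obtain ⟨d', hd'⟩ : ∃ d', HasDerivAt d d' t :=
    ⟨_, (differentiable_lowerFactor (differentiable_gramKer ξ) hu t).hasDerivAt⟩
  obtain ⟨a', ha'⟩ : ∃ a', HasDerivAt a a' t :=
    ⟨_, (swapKer.differentiable.comp
      (differentiable_resolventKer (differentiable_gramKer ξ) hu) t).hasDerivAt⟩
  have hD := (differentiable_laxKer ξ κ₀ t).hasDerivAt
  set B : ℝ → Op := fun s => 1 + integralOp (d s) with hB
  set A : ℝ → Op := fun s => 1 + integralOp (a s) with hA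
  have hAB : ∀ s, A s * B s = 1 := fun s => resolvent_mul_lowerFactor (hu s) (swapKer_gramKer ξ s)
  have hBA : ∀ s, B s * A s = 1 := fun s => lowerFactor_mul_resolvent (hu s) (swapKer_gramKer ξ s)
  have hB' : HasDerivAt B (integralOp d') t := (hasDerivAt_integralOp hd').const_add 1
  have hA' : HasDerivAt A (integralOp a') t := (hasDerivAt_integralOp ha').const_add 1
  set m := leftMul (A t) d' with hm
  have hM : integralOp m = A t * integralOp d' := integralOp_leftMul _ _
  have hda : integralOp a' * B t = -integralOp m := by
    have h1 := hA'.mul hB'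
    have h2 : A * B = fun _ => 1 := funext hAB
    rw [h2] at h1
    have h3 := h1.unique (hasDerivAt_const t 1)
    rw [hM]
    exact eq_neg_of_add_eq_zero_left h3
  have hlow : upTri d' = 0 := upTri_eq_zero_of_hasDerivAt hd' fun s => upTri_lowerFactor (hu s)
  refine ⟨m, deriv (laxKer ξ κ₀) t, ?_, ?_, hD, ?_⟩
  · have : m = d' + leftMul (integralOp (a t)) d' := by
      rw [hm, hA, map_add, add_apply, leftMul_one]
    rw [this, map_add, hlow, upTri_leftMul_eq_zero (upTri_swapKer_resolventKer (hu t)) hlow,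
      add_zero]
  · refine integralOp_injective ?_
    set g : ℝ → Op := fun s => NormedSpace.exp (s • integralOp ξ) with hg
    have hg' : HasDerivAt g (integralOp ξ * g t) t := hasDerivAt_exp_smul_const' (integralOp ξ) t
    have h1 : (fun s => B s * star (B s)) = fun s => g s * star (g s) := by
      funext s
      exact (lowerFactor_mul_star (hu s) (swapKer_gramKer ξ s)).trans (one_add_gramKer ξ s)
    have h2 : HasDerivAt (fun s => B s * star (B s))
        (integralOp d' * star (B t) + B t * star (integralOp d')) t := hB'.mul hB'.star
    have h3 : HasDerivAt (fun s => g s * star (g s))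
        (integralOp ξ * g t * star (g t) + g t * star (integralOp ξ * g t)) t := hg'.mul hg'.star
    rw [← h1] at h3
    have h4 := h2.unique h3
    have h5 : B t * star (B t) = g t * star (g t) := congrFun h1 t
    have h6 : integralOp (laxKer ξ ξ t) = A t * integralOp ξ * B t := integralOp_laxKer ξ ξ t
    have hsA : star (B t) * star (A t) = 1 := by rw [← star_mul, hAB, star_one]
    have h7 : integralOp m + star (integralOp m) =
        integralOp (laxKer ξ ξ t) + star (integralOp (laxKer ξ ξ t)) := by
      calc integralOp m + star (integralOp m)
          = A t * integralOp d' * (star (B t) * star (A t)) +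
            (A t * B t) * star (integralOp d') * star (A t) := by
            rw [hsA, hAB, hM, star_mul]; noncomm_ring
        _ = A t * (integralOp d' * star (B t) + B t * star (integralOp d')) * star (A t) := by
            noncomm_ring
        _ = A t * (integralOp ξ * (g t * star (g t)) + (g t * star (g t)) * star (integralOp ξ)) *
              star (A t) := by
            rw [h4, star_mul]; noncomm_ring
        _ = A t * integralOp ξ * B t * (star (B t) * star (A t)) +
              (A t * B t) * star (B t) * star (integralOp ξ) * star (A t) := by
            rw [← h5]; noncomm_ring
        _ = _ := by
            rw [hsA, hAB, h6, star_mul, star_mul]; noncomm_ring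
    rw [integralOp_swapKer, integralOp_neg, integralOp_sub, star_sub]
    rw [← sub_eq_zero] at h7 ⊢
    rw [← neg_eq_zero, ← h7]
    abel
  · have h1 := hasDerivAt_integralOp hD
    have h2 : (fun s => integralOp (laxKer ξ κ₀ s)) = fun s => A s * integralOp κ₀ * B s :=
      funext fun s => integralOp_laxKer ξ κ₀ s
    have h3 : HasDerivAt (fun s => A s * integralOp κ₀ * B s)
        (integralOp a' * integralOp κ₀ * B t + A t * integralOp κ₀ * integralOp d') t :=
      (hA'.mul_const (integralOp κ₀)).mul hB'
    rw [h2] at h1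
    rw [h1.unique h3, integralOp_laxKer]
    change _ = ⁅A t * integralOp κ₀ * B t, integralOp m⁆
    rw [Ring.lie_def]
    calc integralOp a' * integralOp κ₀ * B t + A t * integralOp κ₀ * integralOp d'
        = (integralOp a' * (B t * A t)) * integralOp κ₀ * B t +
          A t * integralOp κ₀ * (B t * A t) * integralOp d' := by
          rw [hBA, mul_one, mul_one]
      _ = (integralOp a' * B t) * A t * integralOp κ₀ * B t +
          A t * integralOp κ₀ * B t * (A t * integralOp d') := by noncomm_ring
      _ = _ := by
          rw [hda, ← hM]
          noncomm_ring

/-! ### The integro-differential equation -/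

lemma ae_integrable_mul (κ κ' : Ker) : ∀ᵐ p ∂((volume : Measure ℝ).prod volume),
    Integrable fun z => κ (p.1, z) * κ' (z, p.2) := by
  have h1 := Measure.quasiMeasurePreserving_fst (μ := (volume : Measure ℝ))
    (ν := (volume : Measure ℝ)) |>.ae (ker_section_memLp κ)
  have h2 := Measure.quasiMeasurePreserving_snd (μ := (volume : Measure ℝ))
    (ν := (volume : Measure ℝ)) |>.ae (ker_section_memLp (swapKer κ'))
  have h3 := Measure.quasiMeasurePreserving_snd (μ := (volume : Measure ℝ))
    (ν := (volume : Measure ℝ)) |>.ae (Measure.ae_ae_of_ae_prod (coeFn_swapKer κ'))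
  filter_upwards [h1, h2, h3] with p h4 h5 h6
  exact h4.integrable_mul (h5.ae_eq h6)

lemma leftMul_loTri_ae (κ κ' : Ker) :
    leftMul (integralOp (loTri κ)) κ' =ᵐ[(volume : Measure ℝ).prod volume]
      fun p => ∫ z in Iio p.1, κ (p.1, z) * κ' (z, p.2) := by
  have h1 := Measure.quasiMeasurePreserving_fst (μ := (volume : Measure ℝ))
    (ν := (volume : Measure ℝ)) |>.ae (Measure.ae_ae_of_ae_prod (coeFn_loTri κ))
  filter_upwards [leftMul_integralOp_ae (loTri κ) κ', h1] with p h2 h3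
  rw [h2, ← integral_indicator measurableSet_Iio]
  refine integral_congr_ae ?_
  filter_upwards [h3] with z hz
  rw [hz]
  by_cases h : z < p.1 <;> simp [h]

lemma leftMul_apply_loTri_ae (κ κ' : Ker) :
    leftMul (integralOp κ) (loTri κ') =ᵐ[(volume : Measure ℝ).prod volume]
      fun p => ∫ z in Ioi p.2, κ (p.1, z) * κ' (z, p.2) := by
  have h1 := Measure.quasiMeasurePreserving_snd (μ := (volume : Measure ℝ))
    (ν := (volume : Measure ℝ)) |>.ae (Measure.ae_ae_of_ae_prod (ae_swap (coeFn_loTri κ')))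
  filter_upwards [leftMul_integralOp_ae κ (loTri κ'), h1] with p h2 h3
  rw [h2, ← integral_indicator measurableSet_Ioi]
  refine integral_congr_ae ?_
  filter_upwards [h3] with z hz
  simp only [Prod.swap_prod_mk] at hz
  rw [hz]
  by_cases h : p.2 < z <;> simp [h]

/-- For symmetric kernels the Lax equation is the integro-differential equation, as then
`Π_𝔩 K` has the kernel `2 κ(x,y) χ_{y < x}`. -/
lemma solvesIDEAt_of_hasDerivAt {κ : ℝ → Ker} {D : Ker} {t : ℝ} (h : HasDerivAt κ D t)
    (hsymm : swapKer (κ t) = κ t)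
    (hD : integralOp D = (1 / 2 : ℝ) • ⁅projL (integralOp (κ t)), integralOp (κ t)⁆) :
    SolvesIDEAt κ t := by
  have hD' : D = leftMul (integralOp (loTri (κ t))) (κ t) -
      leftMul (integralOp (κ t)) (loTri (κ t)) := by
    refine integralOp_injective ?_
    have h2 : kerL (κ t) = (2 : ℝ) • loTri (κ t) := by
      rw [kerL_eq, hsymm, map_add, two_smul]
    rw [hD, projL, kernel_integralOp, h2, integralOp_smul, integralOp_sub, integralOp_leftMul,
      integralOp_leftMul, Ring.lie_def, smul_mul_assoc, mul_smul_comm, ← smul_sub, smul_smul]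
    norm_num
  refine ⟨D, h, ?_⟩
  change ∀ᵐ p ∂((volume : Measure ℝ).prod volume), _
  filter_upwards [ae_integrable_mul (κ t) (κ t), leftMul_loTri_ae (κ t) (κ t),
    leftMul_apply_loTri_ae (κ t) (κ t), Lp.coeFn_sub (leftMul (integralOp (loTri (κ t))) (κ t))
      (leftMul (integralOp (κ t)) (loTri (κ t)))] with p h1 h2 h3 h4
  have h5 : D p = (∫ z in Iio p.1, κ t (p.1, z) * κ t (z, p.2)) -
        ∫ z in Ioi p.2, κ t (p.1, z) * κ t (z, p.2) := by
    rw [hD', h4, Pi.sub_apply, h2, h3]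
  refine ⟨h1, h5, ?_⟩
  have h6 : ∀ b : ℝ, (∫ z in Iio b, κ t (p.1, z) * κ t (z, p.2)) +
      ∫ z in Ioi b, κ t (p.1, z) * κ t (z, p.2) = ∫ z, κ t (p.1, z) * κ t (z, p.2) := by
    intro b
    rw [← integral_Ici_eq_integral_Ioi]
    exact intervalIntegral.integral_Iio_add_Ici h1.integrableOn h1.integrableOn
  rw [h5]
  linarith [h6 p.1, h6 p.2]

/-! ### The explicit solution -/

lemma memLp_indicator_Iio {f : ℝ → ℝ} {y : ℝ} (hf : MemLp f 2 (volume.restrict (Iio y))) :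
    MemLp ((Iio y).indicator f) 2 volume :=
  (memLp_indicator_iff_restrict measurableSet_Iio).2 hf

/-- A symmetric positive definite `I + S` stays injective when compressed to `L²(-∞,y)`. -/
lemma ae_eq_zero_of_compression {S : Ker} {g : Opˣ}
    (hg : 1 + integralOp S = (g : Op) * star (g : Op)) {y : ℝ} {f : ℝ → ℝ}
    (hf : MemLp f 2 (volume.restrict (Iio y)))
    (h : ∀ᵐ x ∂(volume.restrict (Iio y)), f x + ∫ z in Iio y, S (x, z) * f z = 0) :
    f =ᵐ[volume.restrict (Iio y)] 0 := by
  have hF := memLp_indicator_Iio hf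
  set F : H := hF.toLp _
  have hFc : F =ᵐ[volume] (Iio y).indicator f := hF.coeFn_toLp
  have h1 : inner ℝ F ((1 + integralOp S) F) = 0 := by
    rw [L2.inner_def]
    refine integral_eq_zero_of_ae ?_
    have h2 : (1 + integralOp S) F = F + integralOp S F := rfl
    rw [h2]
    filter_upwards [hFc, Lp.coeFn_add F (integralOp S F), integralOp_apply S F,
      (ae_restrict_iff' measurableSet_Iio).1 h] with x h3 h4 h5 h6
    rw [h4, Pi.add_apply, h3, h5]
    by_cases hx : x ∈ Iio y
    · have h7 : ∫ z, S (x, z) * F z = ∫ z in Iio y, S (x, z) * f z := by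
        rw [← integral_indicator measurableSet_Iio]
        refine integral_congr_ae ?_
        filter_upwards [hFc] with z hz
        rw [hz]
        by_cases hzy : z < y <;> simp [hzy]
      rw [h7, indicator_of_mem hx, h6 hx, inner_zero_right]
      rfl
    · rw [indicator_of_notMem hx, inner_zero_left]
      rfl
  have h8 : star (g : Op) F = 0 := by
    rw [hg, mul_apply_eq_comp, ← ContinuousLinearMap.adjoint_inner_left,
      ← ContinuousLinearMap.star_eq_adjoint] at h1
    exact inner_self_eq_zero.1 h1
  have h9 : F = 0 := by
    have h10 : star ((g⁻¹ : Opˣ) : Op) * star (g : Op) = 1 := by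
      rw [← star_mul, Units.mul_inv, star_one]
    have h11 := congrArg (fun T : Op => T F) h10
    simp only [mul_apply_eq_comp, h8, map_zero, one_apply_eq_self] at h11
    exact h11.symm
  rw [Filter.EventuallyEq, ae_restrict_iff' measurableSet_Iio]
  have h12 : F =ᵐ[volume] 0 := by
    rw [h9]
    exact Lp.coeFn_zero ℝ 2 volume
  filter_upwards [hFc, h12] with x h13 h14 hx
  rw [← indicator_of_mem hx f, ← h13, h14]

lemma resolventKer_ae_eq_zero {S : Ker} (hS : IsUnit (upCompression (1 + integralOp S))) :
    ∀ᵐ p ∂((volume : Measure ℝ).prod volume), p.2 < p.1 → resolventKer S p = 0 := by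
  filter_upwards [ae_swap (upTri_eq_zero_iff.1 (upTri_swapKer_resolventKer hS)),
    ae_swap (coeFn_swapKer (resolventKer S))] with p h1 h2 h3
  have h4 := h1 h3
  rwa [h2, Prod.swap_swap] at h4

lemma lowerFactor_ae (S : Ker) : lowerFactor S =ᵐ[(volume : Measure ℝ).prod volume]
    fun p => S p + resolventKer S p + ∫ z, S (p.1, z) * resolventKer S (z, p.2) := by
  have h : lowerFactor S =
      S + resolventKer S + leftMul (integralOp S) (resolventKer S) := by
    rw [lowerFactor, map_add, add_apply, leftMul_one, add_assoc]
  rw [h]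
  filter_upwards [Lp.coeFn_add (S + resolventKer S) (leftMul (integralOp S) (resolventKer S)),
    Lp.coeFn_add S (resolventKer S), leftMul_integralOp_ae S (resolventKer S)] with p h1 h2 h3
  rw [h1, Pi.add_apply, h2, h3, Pi.add_apply]

lemma isResolventKernel_resolventKer {S : Ker} {g : Opˣ}
    (hg : 1 + integralOp S = (g : Op) * star (g : Op))
    (hS : IsUnit (upCompression (1 + integralOp S))) :
    IsResolventKernel S (resolventKer S) := by
  set C := resolventKer S with hC
  refine ⟨resolventKer_ae_eq_zero hS, ?_⟩
  have hlow := upTri_eq_zero_iff.1 (upTri_lowerFactor hS)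
  filter_upwards [ker_section_memLp (swapKer C),
    Measure.ae_ae_of_ae_prod (coeFn_swapKer C),
    Measure.ae_ae_of_ae_prod (ae_swap (resolventKer_ae_eq_zero hS)),
    Measure.ae_ae_of_ae_prod (ae_swap hlow),
    Measure.ae_ae_of_ae_prod (ae_swap (lowerFactor_ae S))] with y h1 h2 h3 h4 h5
  have hCy : MemLp (fun x => C (x, y)) 2 volume := h1.ae_eq h2
  have hsol : IsFredholmSolution S y fun x => C (x, y) := by
    refine ⟨hCy.restrict _, (ae_restrict_iff' measurableSet_Iio).2 ?_⟩
    filter_upwards [h4, h5] with x h6 h7 hx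
    have h8 : lowerFactor S (x, y) = 0 := h6 hx
    have h9 : lowerFactor S (x, y) = S (x, y) + C (x, y) + ∫ z, S (x, z) * C (z, y) := h7
    have h10 : ∫ z in Iio y, S (x, z) * C (z, y) = ∫ z, S (x, z) * C (z, y) := by
      rw [← integral_indicator measurableSet_Iio]
      refine integral_congr_ae ?_
      filter_upwards [h3, Measure.ae_ne volume y] with z hz hzy
      rcases lt_or_gt_of_ne hzy with h | h
      · simp [h]
      · have : C (z, y) = 0 := hz h
        simp [h.le, this]
    rw [h10]
    linarith
  refine ⟨hsol, fun f hf => ?_⟩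
  have hd : MemLp (fun x => f x - C (x, y)) 2 (volume.restrict (Iio y)) := hf.1.sub hsol.1
  have h0 : (fun x => f x - C (x, y)) =ᵐ[volume.restrict (Iio y)] 0 := by
    refine ae_eq_zero_of_compression hg hd ?_
    filter_upwards [hf.2, hsol.2, ae_restrict_of_ae (ker_section_memLp S)] with x h6 h7 h8
    have h9 : Integrable (fun z => S (x, z) * f z) (volume.restrict (Iio y)) :=
      (h8.restrict _).integrable_mul hf.1
    have h10 : Integrable (fun z => S (x, z) * C (z, y)) (volume.restrict (Iio y)) :=
      (h8.restrict _).integrable_mul hsol.1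
    simp only [mul_sub]
    rw [integral_sub h9 h10]
    linarith
  filter_upwards [h0] with x hx
  exact sub_eq_zero.1 hx

lemma laxKer_eq (ξ κ₀ : Ker) (t : ℝ) {w : Ker}
    (hw : w = κ₀ + leftMul (integralOp (swapKer (resolventKer (gramKer ξ t)))) κ₀) :
    laxKer ξ κ₀ t = w + leftMul (integralOp w) (lowerFactor (gramKer ξ t)) := by
  refine integralOp_injective ?_
  rw [integralOp_laxKer, integralOp_add, integralOp_leftMul, hw, integralOp_add, integralOp_leftMul]
  noncomm_ring

lemma laxKer_ae_eq_explicitKernel (ξ κ₀ : Ker) (t : ℝ) :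
    laxKer ξ κ₀ t =ᵐ[(volume : Measure ℝ).prod volume]
      explicitKernel κ₀ (gramKer ξ t) (resolventKer (gramKer ξ t)) := by
  set S := gramKer ξ t
  have hS : IsUnit (upCompression (1 + integralOp S)) := isUnit_upCompression_gramKer ξ t
  set C := resolventKer S
  set w := κ₀ + leftMul (integralOp (swapKer C)) κ₀ with hw
  have hwae : w =ᵐ[(volume : Measure ℝ).prod volume]
      fun p => κ₀ p + ∫ ζ, C (ζ, p.1) * κ₀ (ζ, p.2) := by
    have h1 := Measure.quasiMeasurePreserving_fst (μ := (volume : Measure ℝ))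
      (ν := (volume : Measure ℝ)) |>.ae (Measure.ae_ae_of_ae_prod (coeFn_swapKer C))
    filter_upwards [Lp.coeFn_add κ₀ (leftMul (integralOp (swapKer C)) κ₀),
      leftMul_integralOp_ae (swapKer C) κ₀, h1] with p h2 h3 h4
    rw [hw, h2, Pi.add_apply, h3]
    congr 1
    refine integral_congr_ae ?_
    filter_upwards [h4] with z hz
    rw [hz]
    rfl
  have h1 := Measure.quasiMeasurePreserving_fst (μ := (volume : Measure ℝ))
    (ν := (volume : Measure ℝ)) |>.ae (Measure.ae_ae_of_ae_prod hwae)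
  have h2 := Measure.quasiMeasurePreserving_snd (μ := (volume : Measure ℝ))
    (ν := (volume : Measure ℝ)) |>.ae (Measure.ae_ae_of_ae_prod (ae_swap (lowerFactor_ae S)))
  have h3 := Measure.quasiMeasurePreserving_snd (μ := (volume : Measure ℝ))
    (ν := (volume : Measure ℝ)) |>.ae
      (Measure.ae_ae_of_ae_prod (ae_swap (resolventKer_ae_eq_zero hS)))
  have hlo : loTri (lowerFactor S) = lowerFactor S := loTri_eq_self (upTri_lowerFactor hS)
  have hmul := leftMul_apply_loTri_ae w (lowerFactor S)
  rw [hlo] at hmul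
  rw [laxKer_eq ξ κ₀ t hw]
  filter_upwards [Lp.coeFn_add w (leftMul (integralOp w) (lowerFactor S)), hwae, hmul, h1, h2, h3]
    with p h4 h5 h6 h7 h8 h9
  rw [h4, Pi.add_apply, h5, h6, explicitKernel]
  congr 1
  refine integral_congr_ae ((ae_restrict_iff' measurableSet_Ioi).2 ?_)
  filter_upwards [h7, h8, h9] with z h10 h11 h12 hz
  have h13 : lowerFactor S (z, p.2) =
      S (z, p.2) + C (z, p.2) + ∫ ζ, S (z, ζ) * C (ζ, p.2) := h11
  have h14 : C (z, p.2) = 0 := h12 hz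
  rw [h10, h13, h14, add_zero]

/-! ### The flow of the factorization -/

lemma isFactorization_one : IsFactorization 1 1 1 := by
  refine ⟨?_, ⟨?_, ?_⟩, ?_⟩
  · change ((1 : Opˣ) : Op) - 1 ∈ lowerAlgebra
    exact mem_lowerAlgebra_iff.2 ⟨0, map_zero _, by simp [integralOp_zero]⟩
  · change IsHilbertSchmidt (((1 : Opˣ) : Op) - 1)
    exact isHilbertSchmidt_iff.2 ⟨0, by simp [integralOp_zero]⟩
  · rw [← ContinuousLinearMap.star_eq_adjoint]
    simp
  · simp

/-- The lower triangular factor of `exp (t X)`. -/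
def lowerFlow (ξ : Ker) (t : ℝ) : Opˣ :=
  lowerUnit (isUnit_upCompression_gramKer ξ t) (swapKer_gramKer ξ t)

lemma isFactorization_lowerFlow (ξ : Ker) (t : ℝ) :
    IsFactorization (NormedSpace.exp (t • integralOp ξ)) (lowerFlow ξ t)
      ((expUnit ξ t)⁻¹ * lowerFlow ξ t) :=
  isFactorization_lowerUnit (g := expUnit ξ t) (one_add_expKer ξ t).symm (one_add_gramKer ξ t)
    (isUnit_upCompression_gramKer ξ t)

lemma integralOp_laxKer_eq (ξ κ₀ : Ker) (t : ℝ) :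
    integralOp (laxKer ξ κ₀ t) =
      (((lowerFlow ξ t)⁻¹ : Opˣ) : Op) * integralOp κ₀ * (lowerFlow ξ t : Op) :=
  integralOp_laxKer ξ κ₀ t

lemma laxKer_smul (ξ κ₀ : Ker) (c t : ℝ) : laxKer ξ (c • κ₀) t = c • laxKer ξ κ₀ t := by
  refine integralOp_injective ?_
  rw [integralOp_smul, integralOp_laxKer, integralOp_laxKer, integralOp_smul, mul_smul_comm,
    smul_mul_assoc]

/-- The Lax equation with the projection onto the lower triangular part. -/
lemma hasHSDerivAt_laxKer (κ₀ : Ker) (t : ℝ) :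
    HasHSDerivAt (fun s => integralOp (laxKer (-(1 / 2 : ℝ) • κ₀) κ₀ s))
      ((1 / 2 : ℝ) • ⁅projL (integralOp (laxKer (-(1 / 2 : ℝ) • κ₀) κ₀ t)),
        integralOp (laxKer (-(1 / 2 : ℝ) • κ₀) κ₀ t)⁆) t := by
  set ξ := -(1 / 2 : ℝ) • κ₀ with hξ
  obtain ⟨m, D, hm, hn, hD, hD'⟩ := exists_hasDerivAt_laxKer ξ κ₀ t
  set κ := laxKer ξ κ₀ t
  have h1 : laxKer ξ ξ t = -(1 / 2 : ℝ) • κ := by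
    conv_lhs => arg 2; rw [hξ]
    exact laxKer_smul ξ κ₀ _ t
  have h2 : kerL κ = (-2 : ℝ) • m := by
    have h3 : κ = (-2 : ℝ) • m + (-2 : ℝ) • (laxKer ξ ξ t - m) := by
      rw [h1]
      module
    rw [h3]
    exact kerL_add_of_skew (by rw [map_smul, hm, smul_zero])
      (by rw [map_smul, hn, smul_neg])
  have h4 : (1 / 2 : ℝ) • ⁅projL (integralOp κ), integralOp κ⁆ = integralOp D := by
    rw [hD', projL, kernel_integralOp, h2, integralOp_smul, Ring.lie_def, Ring.lie_def,
      smul_mul_assoc, mul_smul_comm, ← smul_sub, smul_smul]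
    norm_num
  rw [h4]
  refine ⟨fun s => isHilbertSchmidt_integralOp _, isHilbertSchmidt_integralOp _, ?_⟩
  simpa only [kernel_integralOp] using hD

lemma half_lie_projL_eq {K : Op} (hK : IsHilbertSchmidt K) :
    (1 / 2 : ℝ) • ⁅projL K, K⁆ = (1 / 2 : ℝ) • ⁅K, projK K⁆ := by
  congr 1
  have h : projK K = K - projL K := eq_sub_of_add_eq' (projL_add_projK hK)
  rw [h, Ring.lie_def, Ring.lie_def]
  noncomm_ring

lemma IsFactorization.conj_eq {K₀ : Op} {c : ℝ} {bm bp : Opˣ}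
    (h : IsFactorization (NormedSpace.exp (c • K₀)) bm bp) :
    ((bm⁻¹ : Opˣ) : Op) * K₀ * (bm : Op) = ((bp⁻¹ : Opˣ) : Op) * K₀ * (bp : Op) := by
  set g : Op := NormedSpace.exp (c • K₀)
  have hcomm : K₀ * g = g * K₀ := (((Commute.refl K₀).smul_right c).exp_right).eq
  have h1 : g = bm * ((bp⁻¹ : Opˣ) : Op) := h.2.2
  have h2 : (bm : Op) = g * bp := by rw [h1, mul_assoc, Units.inv_mul, mul_one]
  have h3 : ((bm⁻¹ : Opˣ) : Op) * g = ((bp⁻¹ : Opˣ) : Op) := by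
    rw [h1, ← mul_assoc, Units.inv_mul, one_mul]
  calc ((bm⁻¹ : Opˣ) : Op) * K₀ * (bm : Op) = ((bm⁻¹ : Opˣ) : Op) * (K₀ * g) * bp := by
        rw [h2]; noncomm_ring
    _ = (((bm⁻¹ : Opˣ) : Op) * g) * K₀ * bp := by rw [hcomm]; noncomm_ring
    _ = _ := by rw [h3]

lemma star_conj_orthGroup {K₀ : Op} (hK₀ : star K₀ = K₀) {b : Opˣ} (hb : b ∈ orthGroup) :
    star (((b⁻¹ : Opˣ) : Op) * K₀ * (b : Op)) = ((b⁻¹ : Opˣ) : Op) * K₀ * (b : Op) := by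
  have h : star (b : Op) = ((b⁻¹ : Opˣ) : Op) := by
    have h1 := hb.2.1
    rw [← ContinuousLinearMap.star_eq_adjoint] at h1
    exact (Units.inv_eq_of_mul_eq_one_right h1).symm
  rw [← h, star_mul, star_mul, star_star, hK₀, mul_assoc]

lemma exp_mul_star_exp {K₀ : Op} (hK₀ : star K₀ = K₀) (t : ℝ) :
    NormedSpace.exp (-(t / 2) • K₀) * star (NormedSpace.exp (-(t / 2) • K₀)) =
      NormedSpace.exp (-t • K₀) := by
  let _ := NormedAlgebra.restrictScalars ℚ ℝ Op
  have h : star (-(t / 2) • K₀) = -(t / 2) • K₀ := by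
    rw [star_smul, hK₀, star_trivial]
  rw [NormedSpace.star_exp, h, ← NormedSpace.exp_add_of_commute (Commute.refl _), ← add_smul]
  congr 2
  ring

end HSToda

end

open HSToda

theorem theorem3p2 (K₀ : HSToda.Op) (hK₀ : HSToda.IsHilbertSchmidt K₀) :
    -- the factorization problem has exactly one solution for every `t`
    (∀ t : ℝ, ∃! b : HSToda.Opˣ × HSToda.Opˣ,
      HSToda.IsFactorization (NormedSpace.exp (-(t / 2) • K₀)) b.1 b.2) ∧
    ∀ bm bp : ℝ → HSToda.Opˣ,
      (∀ t : ℝ, HSToda.IsFactorization (NormedSpace.exp (-(t / 2) • K₀)) (bm t) (bp t)) →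
      -- the two formulas for `K(t)` agree
      (∀ t : ℝ, (((bm t)⁻¹ : HSToda.Opˣ) : HSToda.Op) * K₀ * (bm t : HSToda.Op) =
        (((bp t)⁻¹ : HSToda.Opˣ) : HSToda.Op) * K₀ * (bp t : HSToda.Op)) ∧
      ∀ K : ℝ → HSToda.Op,
        (∀ t : ℝ, K t = (((bm t)⁻¹ : HSToda.Opˣ) : HSToda.Op) * K₀ * (bm t : HSToda.Op)) →
        -- the Lax equation and the initial condition
        K 0 = K₀ ∧
        (∀ t : ℝ,
          HSToda.HasHSDerivAt K ((1 / 2 : ℝ) • ⁅HSToda.projL (K t), K t⁆) t ∧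
          (1 / 2 : ℝ) • ⁅HSToda.projL (K t), K t⁆ = (1 / 2 : ℝ) • ⁅K t, HSToda.projK (K t)⁆) ∧
        -- the integro-differential equation and its explicit solution, for symmetric `K₀`
        (ContinuousLinearMap.adjoint K₀ = K₀ →
          ∀ t : ℝ,
            ContinuousLinearMap.adjoint (K t) = K t ∧
            HSToda.SolvesIDEAt (fun s => HSToda.kernel (K s)) t ∧
            ∃ S C : HSToda.Ker,
              HSToda.integralOp S = NormedSpace.exp (-t • K₀) - 1 ∧
              HSToda.integralOp C =
                ContinuousLinearMap.adjoint (((bm t)⁻¹ : HSToda.Opˣ) : HSToda.Op) - 1 ∧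
              HSToda.IsResolventKernel S C ∧
              ∀ᵐ p : ℝ × ℝ,
                HSToda.kernel (K t) p = HSToda.explicitKernel (HSToda.kernel K₀) S C p) := by
  obtain ⟨κ₀, rfl⟩ := isHilbertSchmidt_iff.1 hK₀
  set ξ : Ker := -(1 / 2 : ℝ) • κ₀ with hξ
  have hexp : ∀ t : ℝ, -(t / 2) • integralOp κ₀ = t • integralOp ξ := by
    intro t
    rw [hξ, integralOp_smul, smul_smul]
    congr 1
    ring
  have hfact : ∀ t : ℝ, IsFactorization (NormedSpace.exp (-(t / 2) • integralOp κ₀))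
      (lowerFlow ξ t) ((expUnit ξ t)⁻¹ * lowerFlow ξ t) := fun t => by
    rw [hexp]
    exact isFactorization_lowerFlow ξ t
  refine ⟨fun t => ⟨(_, _), hfact t, fun b hb => ?_⟩, fun bm bp hb => ⟨fun t => (hb t).conj_eq,
    fun K hK => ?_⟩⟩
  · obtain ⟨h1, h2⟩ := IsFactorization.unique hb (hfact t)
    exact Prod.ext h1 h2
  have hbm : ∀ t, bm t = lowerFlow ξ t := fun t => ((hb t).unique (hfact t)).1
  have hKt : K = fun t => integralOp (laxKer ξ κ₀ t) := by
    funext t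
    rw [hK, hbm, integralOp_laxKer_eq]
  have hHS : ∀ t, HasHSDerivAt K ((1 / 2 : ℝ) • ⁅projL (K t), K t⁆) t := by
    rw [hKt]
    exact hasHSDerivAt_laxKer κ₀
  refine ⟨?_, fun t => ⟨hHS t, half_lie_projL_eq ((hHS t).1 t)⟩, fun hsymm t => ?_⟩
  · have h0 := hb 0
    rw [zero_div, neg_zero, zero_smul, NormedSpace.exp_zero] at h0
    rw [hK, (h0.unique isFactorization_one).1]
    simp
  have hstar : star (K t) = K t := by
    rw [hK, (hb t).conj_eq]
    exact star_conj_orthGroup hsymm (hb t).2.1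
  refine ⟨hstar, ?_, gramKer ξ t, resolventKer (gramKer ξ t), ?_, ?_, ?_, ?_⟩
  · refine solvesIDEAt_of_hasDerivAt (hHS t).2.2 ?_ ?_
    · refine integralOp_injective ?_
      rw [integralOp_swapKer, integralOp_kernel ((hHS t).1 t), hstar]
    · rw [integralOp_kernel ((hHS t).1 t), integralOp_kernel (hHS t).2.1]
  · rw [← exp_mul_star_exp hsymm, hexp, ← one_add_gramKer, add_sub_cancel_left]
  · rw [hbm, ← ContinuousLinearMap.star_eq_adjoint]
    change _ = star (1 + integralOp (swapKer (resolventKer (gramKer ξ t)))) - 1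
    rw [star_one_add_integralOp, swapKer_swapKer, add_sub_cancel_left]
  · exact isResolventKernel_resolventKer (g := expUnit ξ t) (one_add_gramKer ξ t)
      (isUnit_upCompression_gramKer ξ t)
  · rw [hKt, kernel_integralOp, kernel_integralOp]
    exact laxKer_ae_eq_explicitKernel ξ κ₀ t
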